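/- A (real) Riesz space is a vector lattice over $\mathbb R$. An element $e\ge 0$ of a Riesz space $E$ is a weak order unit if $|x|\wedge e=0$ implies $x=0$. A component of $e$ is an element $p\in E$ with $0\le p\le e$ and $(e-p)\wedge p=0$. A sequence $(x_n)$ in $E$ converges to $x$ in order if there is a decreasing sequence $(u_n)$ in $E$ with infimum $0$ such that $|x_n-x|\le u_n$ for all $n$. A sequence $(p_n)_{n\ge 0}$ of components of $e$ is said to be of density zero if $\frac1n\sum_{k=0}^{n-1}p_k\to 0$ in order as $n\to\infty$. For Dedekind complete Riesz spaces $E$ and $F$, let $E\,\overline{\otimes}\,F$ be the Fremlin tensor product, i.e. the Archimedean Riesz space with a Riesz bimorphism $(x,y)\mapsto x\otimes y$ from $E\times F$ through which every Riesz bimorphism from $E\times F$ into an Archimedean Riesz space factors by a unique Riesz homomorphism, and let $\overline{E\,\overline{\otimes}\,F}^{\,\delta}$ be its Dedekind completion. **Proposition.** Let $E$ and $F$ be Dedekind complete Riesz spaces with weak order units $e$ and $f$ respectively. Let $(p_n)_{n\ge0}$ be a sequence of components of $e$ and $(q_n)_{n\ge0}$ a sequence of components of $f$, at least one of which is of density zero.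 Then $(p_n\otimes q_n)_{n\ge0}$ is a density zero sequence of components of $e\otimes f$ in $\overline{E\,\overline{\otimes}\,F}^{\,\delta}$; that is, every $p_n\otimes q_n$ is a component of $e\otimes f$, and $\frac1n\sum_{k=0}^{n-1}p_k\otimes q_k\to0$ in order in $\overline{E\,\overline{\otimes}\,F}^{\,\delta}$ as $n\to\infty$. -/

import Mathlib

set_option linter.unusedSectionVars false

/-! A (real) Riesz space is a lattice-ordered real vector space, i.e. a type `E` with
`[AddCommGroup E] [Lattice E] [IsOrderedAddMonoid E] [Module ℝ E] [IsOrderedModule ℝ E]`.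
It is Dedekind complete when the lattice is a `ConditionallyCompleteLattice`. -/

/-! ### Riesz space notions -/

/-- A Riesz space is Archimedean if `n x ≤ y` for all `n` implies `x ≤ 0`. -/
class IsArchimedeanRiesz (E : Type*) [AddCommGroup E] [Lattice E] : Prop where
  le_zero : ∀ x y : E, (∀ n : ℕ, n • x ≤ y) → x ≤ 0

section Notions

variable {E : Type*} [AddCommGroup E] [Lattice E]

/-- `e` is a weak order unit: `e ≥ 0`, and only `0` is disjoint from `e`. -/
def IsWeakOrderUnit (e : E) : Prop :=
  0 ≤ e ∧ ∀ x : E, |x| ⊓ e = 0 → x = 0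

/-- `p` is a component of `e`. -/
def IsComponent (e p : E) : Prop :=
  0 ≤ p ∧ p ≤ e ∧ (e - p) ⊓ p = 0

/-- The sequence `x` converges to `l` in order: `|x n - l| ≤ u n` for a sequence `u n ↓ 0`. -/
def OrderConverges (x : ℕ → E) (l : E) : Prop :=
  ∃ u : ℕ → E, Antitone u ∧ IsGLB (Set.range u) 0 ∧ ∀ n, |x n - l| ≤ u n

/-- `p` is a density zero sequence of components of `e`: every `p n` is a component of `e` and
the Cesàro means `(1/n) ∑_{k<n} p k` converge to `0` in order. -/
def IsDensityZeroSeq [Module ℝ E] (e : E) (p : ℕ → E) : Prop :=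
  (∀ n, IsComponent e (p n)) ∧
    OrderConverges (fun n : ℕ => (1 / (n : ℝ)) • ∑ k ∈ Finset.range n, p k) 0

end Notions

/-- A bilinear map `φ : E × F → G` is a Riesz bimorphism if `φ(x, ·)` and `φ(·, y)` are lattice
homomorphisms for all `x ≥ 0` and `y ≥ 0`. -/
structure IsRieszBimorphism {E F G : Type*}
    [AddCommGroup E] [Lattice E] [Module ℝ E] [AddCommGroup F] [Lattice F] [Module ℝ F]
    [AddCommGroup G] [Lattice G] [Module ℝ G] (φ : E →ₗ[ℝ] F →ₗ[ℝ] G) : Prop where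
  sup_right : ∀ x y y', 0 ≤ x → φ x (y ⊔ y') = φ x y ⊔ φ x y'
  sup_left : ∀ x x' y, 0 ≤ y → φ (x ⊔ x') y = φ x y ⊔ φ x' y

/-! ### The Fremlin tensor product

The Fremlin tensor product of `E` and `F` is the Archimedean Riesz space with a Riesz bimorphism
from `E × F` through which every Riesz bimorphism into an Archimedean Riesz space factors
by a unique Riesz homomorphism. It is built here by generators and relations: formal
Riesz space expressions in symbols `x ⊗ y`, modulo the smallest preorder that makes the quotient
an Archimedean Riesz space and `(x, y) ↦ x ⊗ y` a Riesz bimorphism. The universal property is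
proved below (`FremlinTensor.existsUnique_lift`). -/

namespace FremlinTensor

/-- Formal Riesz space expressions in the symbols `x ⊗ y`. -/
inductive Term (E F : Type*)
  | tmul (x : E) (y : F)
  | zero
  | add (s t : Term E F)
  | smul (c : ℝ) (s : Term E F)
  | sup (s t : Term E F)
  | inf (s t : Term E F)

section

variable (E F : Type*) [AddCommGroup E] [Lattice E] [Module ℝ E]
  [AddCommGroup F] [Lattice F] [Module ℝ F]

/-- The identities imposed: vector space axioms, bilinearity and the bimorphism identities. -/
inductive Identity : Term E F → Term E F → Prop
  | add_assoc (r s t : Term E F) : Identity ((r.add s).add t) (r.add (s.add t))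
  | add_comm (s t : Term E F) : Identity (s.add t) (t.add s)
  | zero_add (s : Term E F) : Identity (Term.zero.add s) s
  | zero_smul (s : Term E F) : Identity (s.smul 0) Term.zero
  | one_smul (s : Term E F) : Identity (s.smul 1) s
  | mul_smul (c d : ℝ) (s : Term E F) : Identity (s.smul (c * d)) ((s.smul d).smul c)
  | add_smul (c d : ℝ) (s : Term E F) : Identity (s.smul (c + d)) ((s.smul c).add (s.smul d))
  | smul_add (c : ℝ) (s t : Term E F) : Identity ((s.add t).smul c) ((s.smul c).add (t.smul c))
  | add_tmul (x x' : E) (y : F) : Identity (.tmul (x + x') y) ((Term.tmul x y).add (.tmul x' y))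
  | smul_tmul (c : ℝ) (x : E) (y : F) : Identity (.tmul (c • x) y) ((Term.tmul x y).smul c)
  | tmul_add (x : E) (y y' : F) : Identity (.tmul x (y + y')) ((Term.tmul x y).add (.tmul x y'))
  | tmul_smul (c : ℝ) (x : E) (y : F) : Identity (.tmul x (c • y)) ((Term.tmul x y).smul c)
  | sup_tmul (x x' : E) (y : F) (hy : 0 ≤ y) :
      Identity (.tmul (x ⊔ x') y) ((Term.tmul x y).sup (.tmul x' y))
  | tmul_sup (x : E) (y y' : F) (hx : 0 ≤ x) :
      Identity (.tmul x (y ⊔ y')) ((Term.tmul x y).sup (.tmul x y'))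

/-- The smallest preorder on expressions that contains the identities (in both directions), is
compatible with the operations, makes `sup` and `inf` suprema and infima, and is Archimedean. -/
inductive Le : Term E F → Term E F → Prop
  | of_identity {s t : Term E F} (h : Identity E F s t) : Le s t
  | of_identity_symm {s t : Term E F} (h : Identity E F s t) : Le t s
  | refl (s : Term E F) : Le s s
  | trans {r s t : Term E F} (h : Le r s) (h' : Le s t) : Le r t
  | add_left (r : Term E F) {s t : Term E F} (h : Le s t) : Le (r.add s) (r.add t)
  | smul_nonneg {c : ℝ} (hc : 0 ≤ c) {s t : Term E F} (h : Le s t) : Le (s.smul c) (t.smul c)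
  | smul_nonpos {c : ℝ} (hc : c ≤ 0) {s t : Term E F} (h : Le s t) : Le (t.smul c) (s.smul c)
  | left_le_sup (s t : Term E F) : Le s (s.sup t)
  | right_le_sup (s t : Term E F) : Le t (s.sup t)
  | sup_le {r s t : Term E F} (h : Le r t) (h' : Le s t) : Le (r.sup s) t
  | inf_le_left (s t : Term E F) : Le (s.inf t) s
  | inf_le_right (s t : Term E F) : Le (s.inf t) t
  | le_inf {r s t : Term E F} (h : Le r s) (h' : Le r t) : Le r (s.inf t)
  | arch {s t : Term E F} (h : ∀ n : ℕ, Le (s.smul (n : ℝ)) t) : Le s Term.zero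

/-- Two expressions are identified if each is below the other. -/
def termSetoid : Setoid (Term E F) where
  r s t := Le E F s t ∧ Le E F t s
  iseqv := ⟨fun s => ⟨.refl s, .refl s⟩, fun h => ⟨h.2, h.1⟩,
    fun h h' => ⟨h.1.trans h'.1, h'.2.trans h.2⟩⟩

end

end FremlinTensor

/-- The Fremlin tensor product of the Riesz spaces `E` and `F`. -/
def FremlinTensorProduct (E F : Type*) [AddCommGroup E] [Lattice E] [Module ℝ E]
    [AddCommGroup F] [Lattice F] [Module ℝ F] : Type _ :=
  Quotient (FremlinTensor.termSetoid E F)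

namespace FremlinTensor

variable {E F : Type*} [AddCommGroup E] [Lattice E] [Module ℝ E]
  [AddCommGroup F] [Lattice F] [Module ℝ F]

/-- The class of an expression in the tensor product. -/
def mk (s : Term E F) : FremlinTensorProduct E F := Quotient.mk (termSetoid E F) s

theorem mk_eq {s t : Term E F} (h : Identity E F s t) : mk s = mk t :=
  Quotient.sound ⟨.of_identity h, .of_identity_symm h⟩

theorem ind {P : FremlinTensorProduct E F → Prop} (h : ∀ s, P (mk s)) (a) : P a :=
  Quotient.ind h a

theorem Le.add {r s t u : Term E F} (h : Le E F r s) (h' : Le E F t u) :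
    Le E F (r.add t) (s.add u) :=
  (Le.add_left r h').trans <| (Le.of_identity (.add_comm _ _)).trans <|
    (Le.add_left u h).trans (Le.of_identity (.add_comm _ _))

instance : Zero (FremlinTensorProduct E F) := ⟨mk .zero⟩

instance : Add (FremlinTensorProduct E F) :=
  ⟨Quotient.map₂ Term.add fun _ _ h _ _ h' => ⟨h.1.add h'.1, h.2.add h'.2⟩⟩

instance : SMul ℝ (FremlinTensorProduct E F) :=
  ⟨fun c => Quotient.map (Term.smul c) fun _ _ h => by
    rcases le_total 0 c with hc | hc
    · exact ⟨.smul_nonneg hc h.1, .smul_nonneg hc h.2⟩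
    · exact ⟨.smul_nonpos hc h.2, .smul_nonpos hc h.1⟩⟩

instance : Neg (FremlinTensorProduct E F) := ⟨fun a => (-1 : ℝ) • a⟩

theorem mk_zero : mk (.zero : Term E F) = 0 := rfl
theorem mk_add (s t : Term E F) : mk (s.add t) = mk s + mk t := rfl
theorem mk_smul (c : ℝ) (s : Term E F) : mk (s.smul c) = c • mk s := rfl

instance : AddCommGroup (FremlinTensorProduct E F) where
  add_assoc a b c := by
    induction a using ind; induction b using ind; induction c using ind
    exact mk_eq (.add_assoc _ _ _)
  add_comm a b := by
    induction a using ind; induction b using ind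
    exact mk_eq (.add_comm _ _)
  zero_add a := by
    induction a using ind
    exact mk_eq (.zero_add _)
  add_zero a := by
    induction a using ind with | h s =>
    exact (mk_eq (.add_comm s .zero)).trans (mk_eq (.zero_add s))
  neg_add_cancel a := by
    induction a using ind with | h s =>
    have h1 : (1 : ℝ) • mk s = mk s := mk_eq (.one_smul s)
    have h2 : ((-1 : ℝ) + 1) • mk s = (-1 : ℝ) • mk s + (1 : ℝ) • mk s :=
      mk_eq (.add_smul (-1) 1 s)
    have h3 : (0 : ℝ) • mk s = 0 := mk_eq (.zero_smul s)
    rw [neg_add_cancel, h3, h1] at h2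
    exact h2.symm
  nsmul := nsmulRec
  zsmul := zsmulRec

instance : Module ℝ (FremlinTensorProduct E F) where
  one_smul a := by
    induction a using ind
    exact mk_eq (.one_smul _)
  mul_smul c d a := by
    induction a using ind
    exact mk_eq (.mul_smul _ _ _)
  smul_zero c := by
    have h : (0 : ℝ) • mk (.zero : Term E F) = mk .zero := mk_eq (.zero_smul _)
    have h2 : (c * 0) • mk (.zero : Term E F) = c • (0 : ℝ) • mk .zero :=
      mk_eq (.mul_smul c 0 .zero)
    rw [mul_zero, h] at h2
    exact h2.symm
  smul_add c a b := by
    induction a using ind; induction b using ind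
    exact mk_eq (.smul_add _ _ _)
  add_smul c d a := by
    induction a using ind
    exact mk_eq (.add_smul _ _ _)
  zero_smul a := by
    induction a using ind
    exact mk_eq (.zero_smul _)

instance : LE (FremlinTensorProduct E F) :=
  ⟨Quotient.lift₂ (Le E F) fun _ _ _ _ h h' => propext
    ⟨fun k => (h.2.trans k).trans h'.1, fun k => (h.1.trans k).trans h'.2⟩⟩

theorem mk_le {s t : Term E F} : mk s ≤ mk t ↔ Le E F s t := Iff.rfl

instance : Lattice (FremlinTensorProduct E F) where
  le_refl a := by
    induction a using ind
    exact Le.refl _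
  le_trans a b c := by
    induction a using ind; induction b using ind; induction c using ind
    exact Le.trans
  le_antisymm a b := by
    induction a using ind; induction b using ind
    exact fun h h' => Quotient.sound ⟨h, h'⟩
  sup := Quotient.map₂ Term.sup fun _ _ h _ _ h' =>
    ⟨.sup_le (h.1.trans (.left_le_sup _ _)) (h'.1.trans (.right_le_sup _ _)),
      .sup_le (h.2.trans (.left_le_sup _ _)) (h'.2.trans (.right_le_sup _ _))⟩
  le_sup_left a b := by
    induction a using ind; induction b using ind
    exact Le.left_le_sup _ _
  le_sup_right a b := by
    induction a using ind; induction b using ind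
    exact Le.right_le_sup _ _
  sup_le a b c := by
    induction a using ind; induction b using ind; induction c using ind
    exact Le.sup_le
  inf := Quotient.map₂ Term.inf fun _ _ h _ _ h' =>
    ⟨.le_inf ((Le.inf_le_left _ _).trans h.1) ((Le.inf_le_right _ _).trans h'.1),
      .le_inf ((Le.inf_le_left _ _).trans h.2) ((Le.inf_le_right _ _).trans h'.2)⟩
  inf_le_left a b := by
    induction a using ind; induction b using ind
    exact Le.inf_le_left _ _
  inf_le_right a b := by
    induction a using ind; induction b using ind
    exact Le.inf_le_right _ _
  le_inf a b c := by
    induction a using ind; induction b using ind; induction c using ind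
    exact Le.le_inf

theorem mk_sup (s t : Term E F) : mk (s.sup t) = mk s ⊔ mk t := rfl
theorem mk_inf (s t : Term E F) : mk (s.inf t) = mk s ⊓ mk t := rfl

instance : IsOrderedAddMonoid (FremlinTensorProduct E F) where
  add_le_add_left a b h c := by
    induction a using ind; induction b using ind; induction c using ind
    exact Le.add h (.refl _)

instance : IsOrderedModule ℝ (FremlinTensorProduct E F) :=
  have : PosSMulMono ℝ (FremlinTensorProduct E F) := ⟨fun c hc a b h => by
    induction a using ind; induction b using ind
    exact Le.smul_nonneg hc h⟩
  { smul_le_smul_of_nonneg_right := fun a ha c d hcd => by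
      have h := smul_le_smul_of_nonneg_left ha (sub_nonneg.2 hcd)
      rwa [smul_zero, sub_smul, sub_nonneg] at h }

instance : IsArchimedeanRiesz (FremlinTensorProduct E F) where
  le_zero a b h := by
    induction a using ind with | h s =>
    induction b using ind with | h t =>
    refine Le.arch (t := t) fun n => mk_le.1 ?_
    rw [mk_smul, Nat.cast_smul_eq_nsmul]
    exact h n

variable (E F) in
/-- The canonical bilinear map `(x, y) ↦ x ⊗ y` into the Fremlin tensor product. -/
def tmul : E →ₗ[ℝ] F →ₗ[ℝ] FremlinTensorProduct E F :=
  LinearMap.mk₂ ℝ (fun x y => mk (.tmul x y))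
    (fun _ _ _ => mk_eq (.add_tmul _ _ _)) (fun _ _ _ => mk_eq (.smul_tmul _ _ _))
    (fun _ _ _ => mk_eq (.tmul_add _ _ _)) (fun _ _ _ => mk_eq (.tmul_smul _ _ _))

theorem tmul_isRieszBimorphism : IsRieszBimorphism (tmul E F) where
  sup_right _ _ _ hx := mk_eq (.tmul_sup _ _ _ hx)
  sup_left _ _ _ hy := mk_eq (.sup_tmul _ _ _ hy)

section UniversalProperty

variable {H : Type*} [AddCommGroup H] [Lattice H] [IsOrderedAddMonoid H]
  [Module ℝ H] [IsOrderedModule ℝ H] [IsArchimedeanRiesz H]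

/-- Evaluation of an expression along a bilinear map. -/
def eval (φ : E →ₗ[ℝ] F →ₗ[ℝ] H) : Term E F → H
  | .tmul x y => φ x y
  | .zero => 0
  | .add s t => eval φ s + eval φ t
  | .smul c s => c • eval φ s
  | .sup s t => eval φ s ⊔ eval φ t
  | .inf s t => eval φ s ⊓ eval φ t

theorem eval_identity {φ : E →ₗ[ℝ] F →ₗ[ℝ] H} (hφ : IsRieszBimorphism φ) {s t : Term E F}
    (h : Identity E F s t) : eval φ s = eval φ t := by
  induction h with
  | add_assoc r s t => exact _root_.add_assoc _ _ _
  | add_comm s t => exact _root_.add_comm _ _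
  | zero_add s => exact _root_.zero_add _
  | zero_smul s => exact _root_.zero_smul _ _
  | one_smul s => exact _root_.one_smul _ _
  | mul_smul c d s => exact SemigroupAction.mul_smul _ _ _
  | add_smul c d s => exact _root_.add_smul _ _ _
  | smul_add c s t => exact _root_.smul_add _ _ _
  | add_tmul x x' y => simp [eval]
  | smul_tmul c x y => simp [eval]
  | tmul_add x y y' => simp [eval]
  | tmul_smul c x y => simp [eval]
  | sup_tmul x x' y hy => exact hφ.sup_left _ _ _ hy
  | tmul_sup x y y' hx => exact hφ.sup_right _ _ _ hx

theorem eval_le {φ : E →ₗ[ℝ] F →ₗ[ℝ] H} (hφ : IsRieszBimorphism φ) {s t : Term E F}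
    (h : Le E F s t) : eval φ s ≤ eval φ t := by
  induction h with
  | of_identity h => exact (eval_identity hφ h).le
  | of_identity_symm h => exact (eval_identity hφ h).ge
  | refl s => exact le_rfl
  | trans _ _ h h' => exact h.trans h'
  | add_left r _ h => exact add_le_add_right h _
  | smul_nonneg hc _ h => exact smul_le_smul_of_nonneg_left h hc
  | smul_nonpos hc _ h => exact smul_le_smul_of_nonpos_left h hc
  | left_le_sup s t => exact le_sup_left
  | right_le_sup s t => exact le_sup_right
  | sup_le _ _ h h' => exact _root_.sup_le h h'
  | inf_le_left s t => exact _root_.inf_le_left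
  | inf_le_right s t => exact _root_.inf_le_right
  | le_inf _ _ h h' => exact _root_.le_inf h h'
  | @arch _ t _ h =>
    refine IsArchimedeanRiesz.le_zero _ (eval φ t) fun n => ?_
    have := h n
    rwa [eval, Nat.cast_smul_eq_nsmul] at this

/-- The universal property of the Fremlin tensor product. -/
theorem existsUnique_lift (φ : E →ₗ[ℝ] F →ₗ[ℝ] H) (hφ : IsRieszBimorphism φ) :
    ∃! T : FremlinTensorProduct E F →ₗ[ℝ] H,
      (∀ a b, T (a ⊔ b) = T a ⊔ T b) ∧ ∀ x y, T (tmul E F x y) = φ x y := by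
  let T : FremlinTensorProduct E F →ₗ[ℝ] H :=
    { toFun := Quotient.lift (eval φ) fun _ _ h => (eval_le hφ h.1).antisymm (eval_le hφ h.2)
      map_add' := fun a b => by
        induction a using ind; induction b using ind
        rfl
      map_smul' := fun c a => by
        induction a using ind
        rfl }
  refine ⟨T, ⟨fun a b => ?_, fun x y => rfl⟩, fun S hS => LinearMap.ext fun a => ?_⟩
  · induction a using ind; induction b using ind
    rfl
  · induction a using ind with | h s =>
    change S (mk s) = eval φ s
    induction s with
    | tmul x y => exact hS.2 x y
    | zero => exact map_zero S
    | add s t hs ht => rw [mk_add, map_add, hs, ht, eval]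
    | smul c s hs => rw [mk_smul, map_smul, hs, eval]
    | sup s t hs ht => rw [mk_sup, hS.1, hs, ht, eval]
    | inf s t hs ht =>
      have h1 : mk s ⊓ mk t = mk s + mk t - (mk s ⊔ mk t) :=
        eq_sub_of_add_eq (inf_add_sup (mk s) (mk t))
      rw [mk_inf, h1, map_sub, map_add, hS.1, hs, ht, eval]
      exact (eq_sub_of_add_eq (inf_add_sup (eval φ s) (eval φ t))).symm

end UniversalProperty

end FremlinTensor

/-! ### The Dedekind completion

The Dedekind completion of an Archimedean Riesz space `G` consists of its Dedekind cuts with both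
sides nonempty, ordered by inclusion of the left sides. `A + B` is the supremum of the sums `a + b`
with `a ≤ A` and `b ≤ B` in `G`, and `r A` (for `r ≥ 0`) is the supremum of the `r a`
with `a ≤ A`. -/

/-- The Dedekind completion of `G`. -/
def DedekindCompletion (G : Type*) [PartialOrder G] : Type _ :=
  {A : DedekindCut G // A.left.Nonempty ∧ A.right.Nonempty}

namespace DedekindCompletion

section Order

variable {G : Type*} [PartialOrder G]

instance : PartialOrder (DedekindCompletion G) := inferInstanceAs (PartialOrder (Subtype _))

/-- The embedding of `G` into its Dedekind completion. -/
def of (x : G) : DedekindCompletion G :=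
  ⟨DedekindCut.principal x, ⟨x, Set.self_mem_Iic⟩, ⟨x, Set.self_mem_Ici⟩⟩

theorem of_le {x : G} {A : DedekindCompletion G} : of x ≤ A ↔ x ∈ A.1.left :=
  DedekindCut.principal_le_iff

theorem le_of {x : G} {A : DedekindCompletion G} : A ≤ of x ↔ x ∈ A.1.right :=
  DedekindCut.le_principal_iff

theorem of_le_of {x y : G} : of x ≤ of y ↔ x ≤ y := DedekindCut.principal_le_principal

theorem exists_of_le (A : DedekindCompletion G) : ∃ x, of x ≤ A :=
  A.2.1.imp fun _ => of_le.2

theorem exists_le_of (A : DedekindCompletion G) : ∃ x, A ≤ of x :=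
  A.2.2.imp fun _ => le_of.2

theorem le_iff_lower {A B : DedekindCompletion G} : A ≤ B ↔ ∀ x, of x ≤ A → of x ≤ B :=
  ⟨fun h _ hx => hx.trans h, fun h => Concept.extent_subset_extent_iff.1 fun x hx =>
    of_le.1 (h x (of_le.2 hx))⟩

theorem le_iff_upper {A B : DedekindCompletion G} : A ≤ B ↔ ∀ y, B ≤ of y → A ≤ of y :=
  ⟨fun h _ hx => h.trans hx, fun h => Concept.intent_subset_intent_iff.1 fun x hx =>
    le_of.1 (h x (le_of.2 hx))⟩

/-- The supremum in the Dedekind completion of a nonempty subset of `G` that is bounded above. -/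
def sup (S : Set G) (hS : S.Nonempty) (hS' : BddAbove S) : DedekindCompletion G :=
  ⟨⟨lowerBounds (upperBounds S), upperBounds S, Set.Subset.antisymm
      (fun _ hx _ ha => hx (subset_lowerBounds_upperBounds S ha)) (fun _ hx _ ha => ha hx), rfl⟩,
    hS.mono (subset_lowerBounds_upperBounds S), hS'⟩

theorem sup_le {S : Set G} {hS : S.Nonempty} {hS' : BddAbove S} {A : DedekindCompletion G} :
    sup S hS hS' ≤ A ↔ ∀ x ∈ S, of x ≤ A := by
  constructor
  · exact fun h x hx => le_trans (of_le.2 (subset_lowerBounds_upperBounds S hx)) h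
  · exact fun h => le_iff_upper.2 fun y hy =>
      le_of.2 fun x hx => of_le_of.1 ((h x hx).trans hy)

/-- Every element is the supremum of the elements of `G` below it. -/
theorem isLUB_lower (A : DedekindCompletion G) : IsLUB (of '' {x | of x ≤ A}) A :=
  ⟨by rintro _ ⟨x, hx, rfl⟩; exact hx,
    fun _ hB => le_iff_lower.2 fun x hx => hB ⟨x, hx, rfl⟩⟩

/-- Every element is the infimum of the elements of `G` above it. -/
theorem isGLB_upper (A : DedekindCompletion G) : IsGLB (of '' {x | A ≤ of x}) A :=
  ⟨by rintro _ ⟨x, hx, rfl⟩; exact hx,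
    fun _ hB => le_iff_upper.2 fun x hx => hB ⟨x, hx, rfl⟩⟩

end Order

section Lattice

variable {G : Type*} [Lattice G]

instance : Lattice (DedekindCompletion G) where
  sup A B := ⟨A.1 ⊔ B.1, by
    obtain ⟨x, hx⟩ := exists_of_le A
    exact ⟨x, DedekindCut.principal_le_iff.1 (le_trans hx le_sup_left)⟩, by
    obtain ⟨x, hx⟩ := exists_le_of A
    obtain ⟨y, hy⟩ := exists_le_of B
    exact ⟨x ⊔ y, DedekindCut.le_principal_iff.1 (_root_.sup_le
      (le_trans hx (of_le_of.2 le_sup_left)) (le_trans hy (of_le_of.2 le_sup_right)))⟩⟩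
  le_sup_left A B := (le_sup_left : A.1 ≤ A.1 ⊔ B.1)
  le_sup_right A B := (le_sup_right : B.1 ≤ A.1 ⊔ B.1)
  sup_le A B C h h' := (_root_.sup_le h h' : A.1 ⊔ B.1 ≤ C.1)
  inf A B := ⟨A.1 ⊓ B.1, by
    obtain ⟨x, hx⟩ := exists_of_le A
    obtain ⟨y, hy⟩ := exists_of_le B
    exact ⟨x ⊓ y, DedekindCut.principal_le_iff.1 (le_inf
      (le_trans (of_le_of.2 inf_le_left) hx) (le_trans (of_le_of.2 inf_le_right) hy))⟩, by
    obtain ⟨x, hx⟩ := exists_le_of A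
    exact ⟨x, DedekindCut.le_principal_iff.1 (le_trans inf_le_left hx)⟩⟩
  inf_le_left A B := (inf_le_left : A.1 ⊓ B.1 ≤ A.1)
  inf_le_right A B := (inf_le_right : A.1 ⊓ B.1 ≤ B.1)
  le_inf A B C h h' := (le_inf h h' : A.1 ≤ B.1 ⊓ C.1)

theorem of_sup (x y : G) : of (x ⊔ y) = of x ⊔ of y :=
  eq_of_forall_ge_iff fun C => by
    rw [sup_le_iff, le_iff_upper, le_iff_upper (A := of x), le_iff_upper (A := of y)]
    simp only [of_le_of, sup_le_iff, forall_and]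

theorem of_inf (x y : G) : of (x ⊓ y) = of x ⊓ of y :=
  eq_of_forall_le_iff fun C => by
    rw [le_inf_iff, le_iff_lower, le_iff_lower (B := of x), le_iff_lower (B := of y)]
    simp only [of_le_of, le_inf_iff, forall_and]

/-- The Dedekind completion is Dedekind complete. -/
theorem exists_isLUB (S : Set (DedekindCompletion G)) (hS : S.Nonempty) (hS' : BddAbove S) :
    ∃ A, IsLUB S A := by
  obtain ⟨A₀, hA₀⟩ := hS
  obtain ⟨B, hB⟩ := hS'
  obtain ⟨x, hx⟩ := exists_of_le A₀
  obtain ⟨y, hy⟩ := exists_le_of B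
  refine ⟨sup {x | ∃ A ∈ S, of x ≤ A} ⟨x, A₀, hA₀, hx⟩ ⟨y, ?_⟩, fun A hA => ?_, fun C hC => ?_⟩
  · rintro z ⟨A, hA, hz⟩
    exact of_le_of.1 ((hz.trans (hB hA)).trans hy)
  · exact le_iff_lower.2 fun z hz => sup_le.1 le_rfl z ⟨A, hA, hz⟩
  · exact sup_le.2 fun z ⟨A, hA, hz⟩ => hz.trans (hC hA)

end Lattice

section Group

variable {G : Type*} [AddCommGroup G] [Lattice G] [IsOrderedAddMonoid G]

instance : Zero (DedekindCompletion G) := ⟨of 0⟩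

instance : Add (DedekindCompletion G) :=
  ⟨fun A B => sup {z | ∃ a b, of a ≤ A ∧ of b ≤ B ∧ z = a + b}
    (by
      obtain ⟨a, ha⟩ := exists_of_le A
      obtain ⟨b, hb⟩ := exists_of_le B
      exact ⟨a + b, a, b, ha, hb, rfl⟩)
    (by
      obtain ⟨x, hx⟩ := exists_le_of A
      obtain ⟨y, hy⟩ := exists_le_of B
      refine ⟨x + y, ?_⟩
      rintro _ ⟨a, b, ha, hb, rfl⟩
      exact add_le_add (of_le_of.1 (ha.trans hx)) (of_le_of.1 (hb.trans hy)))⟩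

instance : Neg (DedekindCompletion G) :=
  ⟨fun A => sup {z | ∃ y, A ≤ of y ∧ z = -y}
    (by
      obtain ⟨y, hy⟩ := exists_le_of A
      exact ⟨-y, y, hy, rfl⟩)
    (by
      obtain ⟨x, hx⟩ := exists_of_le A
      refine ⟨-x, ?_⟩
      rintro _ ⟨y, hy, rfl⟩
      exact neg_le_neg (of_le_of.1 (hx.trans hy)))⟩

theorem add_le {A B C : DedekindCompletion G} :
    A + B ≤ C ↔ ∀ a b, of a ≤ A → of b ≤ B → of (a + b) ≤ C :=
  sup_le.trans ⟨fun h a b ha hb => h _ ⟨a, b, ha, hb, rfl⟩,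
    by rintro h _ ⟨a, b, ha, hb, rfl⟩; exact h a b ha hb⟩

theorem neg_le {A C : DedekindCompletion G} : -A ≤ C ↔ ∀ y, A ≤ of y → of (-y) ≤ C :=
  sup_le.trans ⟨fun h y hy => h _ ⟨y, hy, rfl⟩, by rintro h _ ⟨y, hy, rfl⟩; exact h y hy⟩

theorem sup_add_sup_le {S T : Set G} {hS hS' hT hT'} {C : DedekindCompletion G} :
    sup S hS hS' + sup T hT hT' ≤ C ↔ ∀ s ∈ S, ∀ t ∈ T, of (s + t) ≤ C := by
  rw [add_le]
  constructor
  · exact fun h s hs t ht => h s t (sup_le.1 le_rfl s hs) (sup_le.1 le_rfl t ht)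
  · refine fun h u v hu hv => le_iff_upper.2 fun y hy => of_le_of.2 ?_
    refine le_sub_iff_add_le.1 (of_le_of.1 (hu.trans (sup_le.2 fun s hs => of_le_of.2 ?_)))
    refine le_sub_comm.1 (of_le_of.1 (hv.trans (sup_le.2 fun t ht => of_le_of.2 ?_)))
    exact le_sub_iff_add_le'.2 (of_le_of.1 ((h s hs t ht).trans hy))

theorem eq_sup (A : DedekindCompletion G) :
    A = sup {x | of x ≤ A} (exists_of_le A)
      ((exists_le_of A).imp fun _ hy _ hx => of_le_of.1 (hx.trans hy)) :=
  eq_of_forall_ge_iff fun _ => le_iff_lower.trans sup_le.symm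

theorem add_add_le {A B C X : DedekindCompletion G} :
    A + B + C ≤ X ↔ ∀ a b c, of a ≤ A → of b ≤ B → of c ≤ C → of (a + b + c) ≤ X := by
  conv_lhs => rw [eq_sup C]
  refine sup_add_sup_le.trans ⟨fun h a b c ha hb hc => h _ ⟨a, b, ha, hb, rfl⟩ c hc, ?_⟩
  rintro h _ ⟨a, b, ha, hb, rfl⟩ c hc
  exact h a b c ha hb hc

protected theorem add_comm (A B : DedekindCompletion G) : A + B = B + A :=
  eq_of_forall_ge_iff fun C => by
    rw [add_le, add_le]
    exact ⟨fun h a b ha hb => add_comm b a ▸ h b a hb ha,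
      fun h a b ha hb => add_comm b a ▸ h b a hb ha⟩

variable [IsArchimedeanRiesz G]

instance : AddCommGroup (DedekindCompletion G) where
  add_assoc A B C := eq_of_forall_ge_iff fun X => by
    rw [add_add_le, DedekindCompletion.add_comm A, add_add_le]
    exact ⟨fun h b c a hb hc ha => by rw [add_comm, ← add_assoc]; exact h a b c ha hb hc,
      fun h a b c ha hb hc => by rw [add_assoc, add_comm]; exact h b c a hb hc ha⟩
  add_comm := DedekindCompletion.add_comm
  zero_add A := eq_of_forall_ge_iff fun C => by
    rw [add_le, le_iff_lower]
    exact ⟨fun h x hx => zero_add x ▸ h 0 x le_rfl hx,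
      fun h a b ha hb => (of_le_of.2 (add_le_of_nonpos_left (of_le_of.1 ha))).trans (h b hb)⟩
  add_zero A := eq_of_forall_ge_iff fun C => by
    rw [add_le, le_iff_lower]
    exact ⟨fun h x hx => add_zero x ▸ h x 0 hx le_rfl,
      fun h a b ha hb => (of_le_of.2 (add_le_of_nonpos_right (of_le_of.1 hb))).trans (h a ha)⟩
  neg_add_cancel A := by
    refine le_antisymm (add_le.2 fun d a hd ha => of_le_of.2 ?_) (le_iff_upper.2 fun w hw => ?_)
    · refine le_neg_iff_add_nonpos_right.1 (of_le_of.1 (hd.trans (neg_le.2 fun y hy => ?_)))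
      exact of_le_of.2 (neg_le_neg (of_le_of.1 (ha.trans hy)))
    · have step : ∀ y, A ≤ of y → A ≤ of (y + w) := fun y hy => le_iff_lower.2 fun a ha => by
        have := of_le_of.1 (add_le.1 hw (-y) a (neg_le.1 le_rfl y hy) ha)
        exact of_le_of.2 (neg_add_le_iff_le_add.1 this)
      obtain ⟨a, ha⟩ := exists_of_le A
      obtain ⟨y, hy⟩ := exists_le_of A
      have iter : ∀ n : ℕ, A ≤ of (y + n • w) := fun n => by
        induction n with
        | zero => simpa using hy
        | succ n ih => rw [succ_nsmul, ← add_assoc]; exact step _ ih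
      refine of_le_of.2 (neg_nonpos.1 (IsArchimedeanRiesz.le_zero (-w) (y - a) fun n => ?_))
      rw [smul_neg, neg_le_sub_iff_le_add]
      exact of_le_of.1 (ha.trans (iter n))
  nsmul := nsmulRec
  zsmul := zsmulRec

instance : IsOrderedAddMonoid (DedekindCompletion G) where
  add_le_add_left _ _ h _ := add_le.2 fun a b ha hb => add_le.1 le_rfl a b (ha.trans h) hb

theorem of_add (x y : G) : of (x + y) = of x + of y :=
  eq_of_forall_ge_iff fun C => by
    rw [add_le]
    exact ⟨fun h a b ha hb =>
      (of_le_of.2 (add_le_add (of_le_of.1 ha) (of_le_of.1 hb))).trans h,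
      fun h => h x y le_rfl le_rfl⟩

end Group

section Module

open scoped NNReal

variable {G : Type*} [AddCommGroup G] [Lattice G] [IsOrderedAddMonoid G]
  [Module ℝ G] [IsOrderedModule ℝ G]

/-- Multiplication by a nonnegative scalar. -/
noncomputable def nnsmul (r : ℝ≥0) (A : DedekindCompletion G) : DedekindCompletion G :=
  sup {z | ∃ a, of a ≤ A ∧ z = (r : ℝ) • a}
    (by
      obtain ⟨a, ha⟩ := exists_of_le A
      exact ⟨(r : ℝ) • a, a, ha, rfl⟩)
    (by
      obtain ⟨y, hy⟩ := exists_le_of A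
      refine ⟨(r : ℝ) • y, ?_⟩
      rintro _ ⟨a, ha, rfl⟩
      exact smul_le_smul_of_nonneg_left (of_le_of.1 (ha.trans hy)) r.2)

theorem nnsmul_le {r : ℝ≥0} {A C : DedekindCompletion G} :
    nnsmul r A ≤ C ↔ ∀ a, of a ≤ A → of ((r : ℝ) • a) ≤ C :=
  sup_le.trans ⟨fun h a ha => h _ ⟨a, ha, rfl⟩, by rintro h _ ⟨a, ha, rfl⟩; exact h a ha⟩

theorem nnsmul_sup_le {r : ℝ≥0} {S : Set G} {hS hS'} {C : DedekindCompletion G} :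
    nnsmul r (sup S hS hS') ≤ C ↔ ∀ s ∈ S, of ((r : ℝ) • s) ≤ C := by
  rw [nnsmul_le]
  constructor
  · exact fun h s hs => h s (sup_le.1 le_rfl s hs)
  · intro h u hu
    rcases eq_or_ne r 0 with rfl | hr
    · obtain ⟨s, hs⟩ := hS
      simpa using h s hs
    · have hr' : 0 < (r : ℝ) := lt_of_le_of_ne r.2 fun h => hr (NNReal.coe_eq_zero.1 h.symm)
      refine le_iff_upper.2 fun y hy => of_le_of.2 ((le_inv_smul_iff_of_pos hr').1 ?_)
      refine of_le_of.1 (hu.trans (sup_le.2 fun s hs => of_le_of.2 ?_))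
      exact (le_inv_smul_iff_of_pos hr').2 (of_le_of.1 ((h s hs).trans hy))

theorem nnsmul_one (A : DedekindCompletion G) : nnsmul 1 A = A :=
  eq_of_forall_ge_iff fun C => by rw [nnsmul_le, le_iff_lower]; simp

theorem nnsmul_mul (r s : ℝ≥0) (A : DedekindCompletion G) :
    nnsmul (r * s) A = nnsmul r (nnsmul s A) :=
  eq_of_forall_ge_iff fun C => by
    rw [nnsmul_le]
    refine Iff.trans ?_ nnsmul_sup_le.symm
    constructor
    · rintro h _ ⟨a, ha, rfl⟩
      rw [← mul_smul, ← NNReal.coe_mul]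
      exact h a ha
    · intro h a ha
      rw [NNReal.coe_mul, mul_smul]
      exact h _ ⟨a, ha, rfl⟩

theorem nnsmul_add (r : ℝ≥0) (A B : DedekindCompletion G) :
    nnsmul r (A + B) = nnsmul r A + nnsmul r B :=
  eq_of_forall_ge_iff fun C => by
    refine nnsmul_sup_le.trans (Iff.trans ?_ sup_add_sup_le.symm)
    constructor
    · rintro h _ ⟨a, ha, rfl⟩ _ ⟨b, hb, rfl⟩
      rw [← smul_add]
      exact h _ ⟨a, b, ha, hb, rfl⟩
    · rintro h _ ⟨a, b, ha, hb, rfl⟩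
      rw [smul_add]
      exact h _ ⟨a, ha, rfl⟩ _ ⟨b, hb, rfl⟩

theorem add_nnsmul (r s : ℝ≥0) (A : DedekindCompletion G) :
    nnsmul (r + s) A = nnsmul r A + nnsmul s A :=
  eq_of_forall_ge_iff fun C => by
    rw [nnsmul_le]
    refine Iff.trans ?_ sup_add_sup_le.symm
    constructor
    · rintro h _ ⟨a, ha, rfl⟩ _ ⟨b, hb, rfl⟩
      have hab : of (a ⊔ b) ≤ A := by rw [of_sup]; exact _root_.sup_le ha hb
      refine le_trans (of_le_of.2 ?_) (h _ hab)
      rw [NNReal.coe_add, add_smul]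
      exact add_le_add (smul_le_smul_of_nonneg_left le_sup_left r.2)
        (smul_le_smul_of_nonneg_left le_sup_right s.2)
    · intro h a ha
      rw [NNReal.coe_add, add_smul]
      exact h _ ⟨a, ha, rfl⟩ _ ⟨a, ha, rfl⟩

variable [IsArchimedeanRiesz G]

/-- `nnsmul r` as an additive homomorphism. -/
noncomputable def nnsmulHom (r : ℝ≥0) : DedekindCompletion G →+ DedekindCompletion G :=
  AddMonoidHom.mk' (nnsmul r) (nnsmul_add r)

theorem nnsmul_sub (r : ℝ≥0) (A B : DedekindCompletion G) :
    nnsmul r (A - B) = nnsmul r A - nnsmul r B := map_sub (nnsmulHom r) A B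

noncomputable instance : SMul ℝ (DedekindCompletion G) :=
  ⟨fun c A => nnsmul c.toNNReal A - nnsmul (-c).toNNReal A⟩

theorem smul_eq {c : ℝ} {r s : ℝ≥0} (h : c = r - s) (A : DedekindCompletion G) :
    c • A = nnsmul r A - nnsmul s A := by
  change nnsmul c.toNNReal A - nnsmul (-c).toNNReal A = _
  rw [sub_eq_sub_iff_add_eq_add, ← add_nnsmul, ← add_nnsmul]
  congr 1
  rw [← NNReal.coe_inj, NNReal.coe_add, NNReal.coe_add, Real.coe_toNNReal', Real.coe_toNNReal']
  rcases le_total 0 c with hc | hc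
  · rw [max_eq_left hc, max_eq_right (neg_nonpos.2 hc)]; linarith
  · rw [max_eq_right hc, max_eq_left (neg_nonneg.2 hc)]; linarith

theorem exists_eq_sub (c : ℝ) : ∃ r s : ℝ≥0, c = r - s :=
  ⟨c.toNNReal, (-c).toNNReal, by
    rw [Real.coe_toNNReal', Real.coe_toNNReal']
    rcases le_total 0 c with hc | hc
    · rw [max_eq_left hc, max_eq_right (neg_nonpos.2 hc)]; simp
    · rw [max_eq_right hc, max_eq_left (neg_nonneg.2 hc)]; simp⟩

theorem nnsmul_zero (A : DedekindCompletion G) : nnsmul 0 A = 0 := by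
  have := add_nnsmul 0 0 A
  rwa [add_zero, left_eq_add] at this

theorem smul_eq_nnsmul (r : ℝ≥0) (A : DedekindCompletion G) : (r : ℝ) • A = nnsmul r A := by
  rw [smul_eq (r := r) (s := 0) (by simp), nnsmul_zero, sub_zero]

noncomputable instance : Module ℝ (DedekindCompletion G) where
  one_smul A := by
    rw [smul_eq (r := 1) (s := 0) (by simp), nnsmul_one, nnsmul_zero, sub_zero]
  mul_smul c d A := by
    obtain ⟨r, s, hc⟩ := exists_eq_sub c
    obtain ⟨t, u, hd⟩ := exists_eq_sub d
    have h : c * d = ((r * t + s * u : ℝ≥0) : ℝ) - (r * u + s * t : ℝ≥0) := by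
      rw [hc, hd]; push_cast; ring
    rw [smul_eq h, smul_eq hc, smul_eq hd]
    simp only [nnsmul_sub, add_nnsmul, nnsmul_mul]
    abel
  smul_zero c := by
    change nnsmulHom c.toNNReal 0 - nnsmulHom (-c).toNNReal 0 = 0
    simp
  smul_add c A B := by
    obtain ⟨r, s, hc⟩ := exists_eq_sub c
    simp only [smul_eq hc, nnsmul_add]
    abel
  add_smul c d A := by
    obtain ⟨r, s, hc⟩ := exists_eq_sub c
    obtain ⟨t, u, hd⟩ := exists_eq_sub d
    have h : c + d = ((r + t : ℝ≥0) : ℝ) - (s + u : ℝ≥0) := by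
      rw [hc, hd]; push_cast; ring
    rw [smul_eq h, smul_eq hc, smul_eq hd]
    simp only [add_nnsmul]
    abel
  zero_smul A := by
    rw [smul_eq (r := 0) (s := 0) (by simp), sub_self]

instance : IsOrderedModule ℝ (DedekindCompletion G) :=
  have : PosSMulMono ℝ (DedekindCompletion G) := ⟨fun c hc A B h => by
    lift c to ℝ≥0 using hc
    change (c : ℝ) • A ≤ (c : ℝ) • B
    rw [smul_eq_nnsmul, smul_eq_nnsmul]
    exact nnsmul_le.2 fun a ha => nnsmul_le.1 le_rfl a (ha.trans h)⟩
  { smul_le_smul_of_nonneg_right := fun a ha c d hcd => by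
      have h := smul_le_smul_of_nonneg_left ha (sub_nonneg.2 hcd)
      rwa [smul_zero, sub_smul, sub_nonneg] at h }

theorem of_nnsmul (r : ℝ≥0) (x : G) : of ((r : ℝ) • x) = (r : ℝ) • of x := by
  rw [smul_eq_nnsmul]
  refine eq_of_forall_ge_iff fun C => ?_
  rw [nnsmul_le]
  exact ⟨fun h a ha => (of_le_of.2 (smul_le_smul_of_nonneg_left (of_le_of.1 ha) r.2)).trans h,
    fun h => h x le_rfl⟩

variable (G) in
/-- The embedding of `G` into its Dedekind completion as a linear map. -/
noncomputable def ofLinear : G →ₗ[ℝ] DedekindCompletion G where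
  toFun := of
  map_add' := of_add
  map_smul' c x := by
    let f : G →+ DedekindCompletion G := AddMonoidHom.mk' of of_add
    obtain ⟨r, s, hc⟩ := exists_eq_sub c
    have h : f (((r : ℝ) - s) • x) = f ((r : ℝ) • x) - f ((s : ℝ) • x) := by
      rw [sub_smul, map_sub]
    have h2 : of (((r : ℝ) - s) • x) = of ((r : ℝ) • x) - of ((s : ℝ) • x) := h
    rw [RingHom.id_apply, hc, h2, sub_smul, of_nnsmul, of_nnsmul]

end Module

end DedekindCompletion

/-! ### The Dedekind completed tensor product -/

/-- The Dedekind completion of the Fremlin tensor product of `E` and `F`. -/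
abbrev DedekindTensorProduct (E F : Type*) [AddCommGroup E] [Lattice E] [Module ℝ E]
    [AddCommGroup F] [Lattice F] [Module ℝ F] : Type _ :=
  DedekindCompletion (FremlinTensorProduct E F)

/-- The elementary tensor `x ⊗ y` in the Dedekind completion of the Fremlin tensor product. -/
def dtmul {E F : Type*} [AddCommGroup E] [Lattice E] [Module ℝ E]
    [AddCommGroup F] [Lattice F] [Module ℝ F] (x : E) (y : F) : DedekindTensorProduct E F :=
  DedekindCompletion.of (FremlinTensor.tmul E F x y)

/-! ### Elementary facts on Riesz spaces -/

namespace RieszSpace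

section Basic

variable {E : Type*} [AddCommGroup E] [Lattice E] [IsOrderedAddMonoid E]

/-! The means of p_k ⊗ q_k lie below (mean of p_k) ⊗ f, hence below u_n ⊗ f when u_n ↓ 0 dominates
the means of the p_k; the other case is symmetric. The difficulty is that u_n ⊗ f must still have
infimum 0. In the completion it is enough to test lower bounds h from the Fremlin tensor product
itself (`isDensityZeroSeq_of`), and such an h is transported to a space where the infimum is
computed pointwise.

The target consists of germs of E-valued functions on the generic points of F, which replace the
points of a function representation of F: each y has a real value y(ω) relative to f at almost every
ω, and (x, y) goes to the germ of ω ↦ y(ω) x (`germBimorphism`). The universal property turns this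
bimorphism into a Riesz homomorphism T. Since f has value 1, T(u_n ⊗ f) is the constant germ u_n; as
the filter is closed under countable intersections, a germ below all u_n is nonpositive
(`germ_nonpos_of_forall_le_const`). Hence T h ≤ 0.

To return to h, T must be injective (`eq_zero_of_map_eq_zero`). Freudenthal's theorem cuts E and F
into finitely many bands such that, on each product of bands, an expression is uniformly close to a
multiple of a ⊗ b. If T kills the element, then on each product either the coefficient is small, or
T kills that piece of a ⊗ b, which is then 0 because T is faithful on positive elementary tensors.
So the element is below arbitrarily small multiples of a ⊗ b in absolute value, hence 0 by the
Archimedean property. Faithfulness comes from the fact that a positive y with value 0 at almost all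
generic points is 0 (`eq_zero_of_eventually_value_eq_zero`). -/

theorem add_inf_le_inf_add_inf {x y z : E} (hx : 0 ≤ x) (hy : 0 ≤ y) (hz : 0 ≤ z) :
    (x + y) ⊓ z ≤ x ⊓ z + y ⊓ z := by
  rw [add_inf, inf_add, inf_add]
  refine le_inf (le_inf inf_le_left (inf_le_right.trans ?_))
    (le_inf (inf_le_right.trans ?_) (inf_le_right.trans ?_))
  · exact le_add_of_nonneg_right hy
  · exact le_add_of_nonneg_left hx
  · exact le_add_of_nonneg_right hz

theorem add_inf_eq_zero {x y z : E} (hx : 0 ≤ x) (hy : 0 ≤ y) (hz : 0 ≤ z)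
    (hxz : x ⊓ z = 0) (hyz : y ⊓ z = 0) : (x + y) ⊓ z = 0 :=
  le_antisymm ((add_inf_le_inf_add_inf hx hy hz).trans (by rw [hxz, hyz, add_zero]))
    (le_inf (add_nonneg hx hy) hz)

theorem inf_eq_zero_of_le {x x' z z' : E} (hx : 0 ≤ x) (hz : 0 ≤ z) (hxx' : x ≤ x')
    (hzz' : z ≤ z') (h : x' ⊓ z' = 0) : x ⊓ z = 0 :=
  le_antisymm ((inf_le_inf hxx' hzz').trans h.le) (le_inf hx hz)

theorem nsmul_inf_eq_zero {x z : E} (hx : 0 ≤ x) (hz : 0 ≤ z) (h : x ⊓ z = 0) (n : ℕ) :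
    (n • x) ⊓ z = 0 := by
  induction n with
  | zero => rw [zero_smul, inf_eq_left.2 hz]
  | succ n ih => rw [succ_nsmul]; exact add_inf_eq_zero (nsmul_nonneg hx n) hx hz ih h

theorem sum_inf_eq_zero {ι : Type*} (s : Finset ι) {f : ι → E} {z : E} (hf : ∀ i ∈ s, 0 ≤ f i)
    (hz : 0 ≤ z) (h : ∀ i ∈ s, f i ⊓ z = 0) : (∑ i ∈ s, f i) ⊓ z = 0 := by
  classical
  induction s using Finset.induction_on with
  | empty => rw [Finset.sum_empty, inf_eq_left.2 hz]
  | insert i s hi ih =>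
    rw [Finset.sum_insert hi]
    exact add_inf_eq_zero (hf i (Finset.mem_insert_self i s))
      (Finset.sum_nonneg fun j hj => hf j (Finset.mem_insert_of_mem hj)) hz
      (h i (Finset.mem_insert_self i s))
      (ih (fun j hj => hf j (Finset.mem_insert_of_mem hj))
        fun j hj => h j (Finset.mem_insert_of_mem hj))

theorem posPart_sub_of_inf_eq_zero {x y : E} (h : x ⊓ y = 0) : (x - y)⁺ = x := by
  have h1 := inf_add_sup x y
  rw [h, zero_add] at h1
  rw [posPart_def, ← sub_self y, ← sup_sub, h1, add_sub_cancel_right]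

theorem posPart_le_abs_self (x : E) : x⁺ ≤ |x| := sup_le (le_abs_self x) (abs_nonneg x)

theorem negPart_le_abs_self (x : E) : x⁻ ≤ |x| := sup_le (neg_le_abs x) (abs_nonneg x)

theorem eq_zero_of_abs_le_zero {x : E} (h : |x| ≤ 0) : x = 0 :=
  le_antisymm ((le_abs_self x).trans h) (neg_nonpos.1 ((neg_le_abs x).trans h))

theorem abs_sup_sub_sup_le_add (x y z w : E) : |x ⊔ y - z ⊔ w| ≤ |x - z| + |y - w| := by
  have h1 := abs_sup_sub_sup_le_abs x z y
  have h2 := abs_sup_sub_sup_le_abs y w z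
  rw [sup_comm y, sup_comm w] at h2
  calc |x ⊔ y - z ⊔ w| = |(x ⊔ y - z ⊔ y) + (z ⊔ y - z ⊔ w)| := by rw [sub_add_sub_cancel]
    _ ≤ _ := (abs_add_le _ _).trans (add_le_add h1 h2)

theorem abs_inf_sub_inf_le_add (x y z w : E) : |x ⊓ y - z ⊓ w| ≤ |x - z| + |y - w| := by
  have h := abs_sup_sub_sup_le_add (-x) (-y) (-z) (-w)
  rw [← neg_inf, ← neg_inf, ← abs_neg, ← abs_neg (-x - -z), ← abs_neg (-y - -w)] at h
  convert h using 2 <;> abel_nf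

theorem abs_sup_le {x y b : E} (hx : |x| ≤ b) (hy : |y| ≤ b) : |x ⊔ y| ≤ b :=
  abs_le'.2 ⟨sup_le (abs_le'.1 hx).1 (abs_le'.1 hy).1,
    (neg_le_neg le_sup_left).trans (abs_le'.1 hx).2⟩

theorem abs_inf_le {x y b : E} (hx : |x| ≤ b) (hy : |y| ≤ b) : |x ⊓ y| ≤ b :=
  abs_le'.2 ⟨inf_le_left.trans (abs_le'.1 hx).1, by
    rw [neg_inf]; exact sup_le (abs_le'.1 hx).2 (abs_le'.1 hy).2⟩

/-- Sums of families dominated by a pairwise disjoint family: the supremum is termwise. -/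
theorem sum_sup_sum_of_disjoint {ι : Type*} [Fintype ι] {d A B : ι → E} (hd : ∀ i, 0 ≤ d i)
    (hdisj : ∀ i j, i ≠ j → d i ⊓ d j = 0) (N : ℕ) (hA : ∀ i, |A i| ≤ N • d i)
    (hB : ∀ i, |B i| ≤ N • d i) : (∑ i, A i) ⊔ ∑ i, B i = ∑ i, A i ⊔ B i := by
  -- The sum of the positive parts is disjoint from the sum of the negative parts: for equal indices
  -- always, for distinct ones by domination by disjoint `d i` and `d j`. Their difference is the
  -- whole sum, so they are its positive and negative parts.
  have key : (∑ i, (A i - B i))⁺ = ∑ i, (A i - B i)⁺ := by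
    have hC : ∀ i, |A i - B i| ≤ (N + N) • d i := fun i => by
      rw [sub_eq_add_neg, add_smul]
      exact (abs_add_le _ _).trans (add_le_add (hA i) (by rw [abs_neg]; exact hB i))
    have h1 : (∑ i, (A i - B i)⁺) ⊓ ∑ i, (A i - B i)⁻ = 0 := by
      refine sum_inf_eq_zero _ (fun i _ => posPart_nonneg _)
        (Finset.sum_nonneg fun i _ => negPart_nonneg _) fun i _ => ?_
      rw [inf_comm]
      refine sum_inf_eq_zero _ (fun i _ => negPart_nonneg _) (posPart_nonneg _) fun j _ => ?_
      rw [inf_comm]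
      rcases eq_or_ne i j with rfl | hij
      · exact posPart_inf_negPart_eq_zero _
      · have h2 : ((N + N) • d i) ⊓ ((N + N) • d j) = 0 := by
          refine nsmul_inf_eq_zero (hd i) (nsmul_nonneg (hd j) _) ?_ _
          rw [inf_comm]
          exact nsmul_inf_eq_zero (hd j) (hd i) (hdisj j i hij.symm) _
        exact inf_eq_zero_of_le (posPart_nonneg _) (negPart_nonneg _)
          ((posPart_le_abs_self _).trans (hC i)) ((negPart_le_abs_self _).trans (hC j)) h2
    rw [← posPart_sub_of_inf_eq_zero h1, ← Finset.sum_sub_distrib]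
    simp only [posPart_sub_negPart]
  have h2 : ∀ x y : E, x ⊔ y = y + (x - y)⁺ := fun x y => by
    rw [posPart_def, add_sup, add_sub_cancel, add_zero]
  simp only [h2, Finset.sum_add_distrib]
  rw [← key, Finset.sum_sub_distrib]

theorem sum_inf_sum_of_disjoint {ι : Type*} [Fintype ι] {d A B : ι → E} (hd : ∀ i, 0 ≤ d i)
    (hdisj : ∀ i j, i ≠ j → d i ⊓ d j = 0) (N : ℕ) (hA : ∀ i, |A i| ≤ N • d i)
    (hB : ∀ i, |B i| ≤ N • d i) : (∑ i, A i) ⊓ ∑ i, B i = ∑ i, A i ⊓ B i := by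
  have h : ∀ x y : E, x ⊓ y = x + y - x ⊔ y := fun x y =>
    eq_sub_of_add_eq (inf_add_sup x y)
  simp only [h, Finset.sum_sub_distrib, Finset.sum_add_distrib]
  rw [sum_sup_sum_of_disjoint hd hdisj N hA hB]

theorem abs_sum_of_disjoint {ι : Type*} [Fintype ι] {d A : ι → E} (hd : ∀ i, 0 ≤ d i)
    (hdisj : ∀ i j, i ≠ j → d i ⊓ d j = 0) (N : ℕ) (hA : ∀ i, |A i| ≤ N • d i) :
    |∑ i, A i| = ∑ i, |A i| := by
  have h := sum_sup_sum_of_disjoint hd hdisj N hA (B := fun i => -A i)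
    (fun i => by rw [abs_neg]; exact hA i)
  rwa [Finset.sum_neg_distrib] at h

end Basic

/-- The supremum `s` of the multiples of `x` satisfies `s ≤ s - x`, because `(n + 1) • x ≤ s` for
every `n`. -/
instance {E : Type*} [AddCommGroup E] [ConditionallyCompleteLattice E] [IsOrderedAddMonoid E] :
    IsArchimedeanRiesz E where
  le_zero x y h := by
    have hb : BddAbove (Set.range fun n : ℕ => n • x) := ⟨y, by rintro _ ⟨n, rfl⟩; exact h n⟩
    have h1 : (⨆ n : ℕ, n • x) ≤ (⨆ n : ℕ, n • x) - x := ciSup_le fun n => by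
      rw [le_sub_iff_add_le, ← succ_nsmul]
      exact le_ciSup hb (n + 1)
    rwa [le_sub_self_iff] at h1

/-! ### Scalars and lattice operations -/

section Module

variable {E : Type*} [AddCommGroup E] [Lattice E] [IsOrderedAddMonoid E] [Module ℝ E]
  [IsOrderedModule ℝ E]

theorem smul_sup_of_nonneg {c : ℝ} (hc : 0 ≤ c) (x y : E) : c • (x ⊔ y) = c • x ⊔ c • y := by
  rcases hc.eq_or_lt with rfl | hc
  · simp
  · refine le_antisymm ?_ (sup_le (smul_le_smul_of_nonneg_left le_sup_left hc.le)
      (smul_le_smul_of_nonneg_left le_sup_right hc.le))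
    rw [← le_inv_smul_iff_of_pos hc]
    exact sup_le ((le_inv_smul_iff_of_pos hc).2 le_sup_left)
      ((le_inv_smul_iff_of_pos hc).2 le_sup_right)

theorem sup_smul_of_nonneg {x : E} (hx : 0 ≤ x) (c d : ℝ) : (c ⊔ d) • x = c • x ⊔ d • x := by
  rcases le_total c d with h | h
  · rw [sup_eq_right.2 h, sup_eq_right.2 (smul_le_smul_of_nonneg_right h hx)]
  · rw [sup_eq_left.2 h, sup_eq_left.2 (smul_le_smul_of_nonneg_right h hx)]

theorem inf_smul_of_nonneg {x : E} (hx : 0 ≤ x) (c d : ℝ) : (c ⊓ d) • x = c • x ⊓ d • x := by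
  rcases le_total c d with h | h
  · rw [inf_eq_left.2 h, inf_eq_left.2 (smul_le_smul_of_nonneg_right h hx)]
  · rw [inf_eq_right.2 h, inf_eq_right.2 (smul_le_smul_of_nonneg_right h hx)]

theorem abs_smul_eq (c : ℝ) (x : E) : |c • x| = |c| • |x| := by
  rcases le_total 0 c with hc | hc
  · rw [abs_of_nonneg hc, abs, abs, smul_sup_of_nonneg hc, smul_neg]
  · rw [abs_of_nonpos hc, abs, abs, smul_sup_of_nonneg (neg_nonneg.2 hc), smul_neg, neg_smul,
      neg_neg, sup_comm]

theorem le_nsmul_of_smul {x : E} (hx : 0 ≤ x) (c : ℝ) : c • x ≤ ⌈c⌉₊ • x := by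
  rw [← Nat.cast_smul_eq_nsmul ℝ]
  exact smul_le_smul_of_nonneg_right (Nat.le_ceil c) hx

theorem smul_inf_eq_zero {x z : E} (hx : 0 ≤ x) (hz : 0 ≤ z) (h : x ⊓ z = 0) {c : ℝ}
    (hc : 0 ≤ c) : (c • x) ⊓ z = 0 :=
  inf_eq_zero_of_le (smul_nonneg hc hx) hz (le_nsmul_of_smul hx c) le_rfl
    (nsmul_inf_eq_zero hx hz h _)

theorem le_zero_of_forall_le_smul [IsArchimedeanRiesz E] {x y : E} (hy : 0 ≤ y)
    (h : ∀ n : ℕ, x ≤ ((n : ℝ) + 1)⁻¹ • y) : x ≤ 0 := by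
  refine IsArchimedeanRiesz.le_zero x y fun n => ?_
  cases n with
  | zero => simpa using hy
  | succ n =>
    have := (le_inv_smul_iff_of_pos (by positivity : (0 : ℝ) < n + 1)).1 (h n)
    rw [← Nat.cast_smul_eq_nsmul ℝ]
    push_cast
    exact this

end Module

end RieszSpace

/-! ### Band projections -/

namespace RieszSpace

section DisjointComplement

variable {E : Type*} [AddCommGroup E] [Lattice E] [IsOrderedAddMonoid E] [Module ℝ E]
  [IsOrderedModule ℝ E]

/-- The disjoint complement of a set, as a submodule. -/
def disjointComplement (S : Set E) : Submodule ℝ E where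
  carrier := {z | ∀ s ∈ S, |z| ⊓ |s| = 0}
  zero_mem' s _ := by rw [abs_zero, inf_eq_left.2 (abs_nonneg s)]
  add_mem' {x y} hx hy s hs := inf_eq_zero_of_le (abs_nonneg _) (abs_nonneg _) (abs_add_le x y)
    le_rfl (add_inf_eq_zero (abs_nonneg _) (abs_nonneg _) (abs_nonneg _) (hx s hs) (hy s hs))
  smul_mem' c x hx s hs := by
    rw [abs_smul_eq]
    exact smul_inf_eq_zero (abs_nonneg _) (abs_nonneg _) (hx s hs) (abs_nonneg c)

/-- A linear map is a band projection if it is idempotent and lies between `0` and the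
identity. -/
structure IsBandProjection (π : E →ₗ[ℝ] E) : Prop where
  nonneg : ∀ x, 0 ≤ x → 0 ≤ π x
  le_self : ∀ x, 0 ≤ x → π x ≤ x
  idem : ∀ x, π (π x) = π x

namespace IsBandProjection

variable {π ρ : E →ₗ[ℝ] E}

theorem id : IsBandProjection (LinearMap.id : E →ₗ[ℝ] E) :=
  ⟨fun _ h => h, fun _ _ => le_rfl, fun _ => rfl⟩

theorem compl (h : IsBandProjection π) : IsBandProjection (LinearMap.id - π) where
  nonneg x hx := sub_nonneg.2 (h.le_self x hx)
  le_self x hx := sub_le_self x (h.nonneg x hx)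
  idem x := by simp [h.idem]

theorem mono (h : IsBandProjection π) {x y : E} (hxy : x ≤ y) : π x ≤ π y := by
  rw [← sub_nonneg, ← map_sub]
  exact h.nonneg _ (sub_nonneg.2 hxy)

/-- Both `π` and `1 - π` send the infimum below 0, the first because it kills `y - π y`, the second
because it kills `π x`; the two images add up to the infimum. -/
theorem disjoint (h : IsBandProjection π) {x y : E} (hx : 0 ≤ x) (hy : 0 ≤ y) :
    π x ⊓ (y - π y) = 0 := by
  have h0 : 0 ≤ π x ⊓ (y - π y) := le_inf (h.nonneg x hx) (h.compl.nonneg y hy)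
  refine le_antisymm ?_ h0
  have h1 : π (π x ⊓ (y - π y)) ≤ 0 :=
    (h.mono inf_le_right).trans_eq (by rw [map_sub, h.idem, sub_self])
  have h2 : (LinearMap.id - π : E →ₗ[ℝ] E) (π x ⊓ (y - π y)) ≤ 0 :=
    (h.compl.mono inf_le_left).trans_eq (by simp [h.idem])
  simpa using add_le_add h1 h2

/-- The range of `π` is solid: applying `1 - π` to `0 ≤ y ≤ π x` squeezes `y - π y` to 0. -/
theorem map_eq_of_le (h : IsBandProjection π) {x y : E} (hy : 0 ≤ y) (hyx : y ≤ π x) :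
    π y = y := by
  have h1 := h.compl.mono hyx
  have h2 := h.compl.nonneg y hy
  simp only [LinearMap.sub_apply, LinearMap.id_apply, h.idem, sub_self] at h1 h2
  exact (sub_eq_zero.1 (le_antisymm h1 h2)).symm

/-- As `ρ` shrinks positive elements and the ranges of `π` and `1 - π` are solid, `ρ` preserves both
the part of `x` in the range of `π` and the complementary part. -/
theorem comm_of_nonneg (h : IsBandProjection π) (h' : IsBandProjection ρ) {x : E} (hx : 0 ≤ x) :
    π (ρ x) = ρ (π x) := by
  have h1 : π (ρ (π x)) = ρ (π x) :=
    h.map_eq_of_le (h'.nonneg _ (h.nonneg x hx)) (h'.le_self _ (h.nonneg x hx))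
  have h2 := h.compl.map_eq_of_le (x := x) (h'.nonneg _ (h.compl.nonneg x hx))
    (h'.le_self _ (h.compl.nonneg x hx))
  simp only [LinearMap.sub_apply, LinearMap.id_apply, map_sub, h1, sub_self, sub_zero] at h2
  exact sub_right_injective h2

theorem comm (h : IsBandProjection π) (h' : IsBandProjection ρ) (x : E) :
    π (ρ x) = ρ (π x) := by
  rw [← posPart_sub_negPart x]
  simp only [map_sub, h.comm_of_nonneg h' (posPart_nonneg x),
    h.comm_of_nonneg h' (negPart_nonneg x)]

theorem comp (h : IsBandProjection π) (h' : IsBandProjection ρ) :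
    IsBandProjection (π ∘ₗ ρ) where
  nonneg x hx := h.nonneg _ (h'.nonneg x hx)
  le_self x hx := (h.le_self _ (h'.nonneg x hx)).trans (h'.le_self x hx)
  idem x := by simp only [LinearMap.comp_apply, ← h.comm h', h'.idem, h.idem]

/-- Since `0 ≤ π ≤ 1`, the images of `z⁺` and `z⁻` stay disjoint, so they are the positive and
negative parts of `π z`. -/
theorem map_sup (h : IsBandProjection π) (x y : E) : π (x ⊔ y) = π x ⊔ π y := by
  have key : ∀ z : E, π z⁺ = (π z)⁺ := fun z => by
    conv_rhs => rw [← posPart_sub_negPart z, LinearMap.map_sub]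
    refine (posPart_sub_of_inf_eq_zero ?_).symm
    exact inf_eq_zero_of_le (h.nonneg _ (posPart_nonneg z)) (h.nonneg _ (negPart_nonneg z))
      (h.le_self _ (posPart_nonneg z)) (h.le_self _ (negPart_nonneg z))
      (posPart_inf_negPart_eq_zero z)
  have h2 : ∀ x y : E, x ⊔ y = y + (x - y)⁺ := fun x y => by
    rw [posPart_def, add_sup, add_sub_cancel, add_zero]
  rw [h2 x, h2 (π x), map_add, key, map_sub]

theorem map_abs (h : IsBandProjection π) (x : E) : |π x| = π |x| := by
  rw [abs, abs, h.map_sup, map_neg]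

end IsBandProjection

end DisjointComplement

/-! ### Band projections in Dedekind complete spaces -/

section Dedekind

variable {E : Type*} [AddCommGroup E] [ConditionallyCompleteLattice E] [IsOrderedAddMonoid E]
  [Module ℝ E] [IsOrderedModule ℝ E]

/-- In a Dedekind complete Riesz space every positive element decomposes along the band generated
by `w` and its disjoint complement. -/
theorem exists_band_decomposition (w : E) {x : E} (hx : 0 ≤ x) :
    ∃ y, 0 ≤ y ∧ y ≤ x ∧ y ∈ disjointComplement (disjointComplement {w} : Set E) ∧
      x - y ∈ disjointComplement {w} := by
  have hb : BddAbove (Set.range fun n : ℕ => x ⊓ n • |w|) :=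
    ⟨x, by rintro _ ⟨n, rfl⟩; exact inf_le_left⟩
  -- The component of `x` in the band generated by `w` is the supremum of the truncations of `x` at
  -- multiples of `|w|`.
  set y := ⨆ n : ℕ, x ⊓ n • |w| with hy
  have hle : ∀ n : ℕ, x ⊓ n • |w| ≤ y := fun n => le_ciSup hb n
  have hy0 : 0 ≤ y := (le_inf hx (nsmul_nonneg (abs_nonneg w) 0)).trans (hle 0)
  have hyx : y ≤ x := ciSup_le fun n => inf_le_left
  refine ⟨y, hy0, hyx, fun z hz => ?_, ?_⟩
  · have hzw : |z| ⊓ |w| = 0 := hz w rfl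
    rw [abs_of_nonneg hy0]
    refine le_antisymm ?_ (le_inf hy0 (abs_nonneg z))
    -- To show that `y ⊓ |z|` is nonpositive, it is added to each truncation without leaving `y`:
    -- the two are disjoint, so their sum is their supremum.
    rw [← le_sub_self_iff y]
    refine ciSup_le fun n => ?_
    rw [le_sub_iff_add_le]
    have h1 : (x ⊓ n • |w|) ⊓ (y ⊓ |z|) = 0 := by
      refine inf_eq_zero_of_le (le_inf hx (nsmul_nonneg (abs_nonneg w) n))
        (le_inf hy0 (abs_nonneg z)) inf_le_right inf_le_right
        (nsmul_inf_eq_zero (abs_nonneg w) (abs_nonneg z) ?_ n)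
      rwa [inf_comm]
    have h2 := inf_add_sup (x ⊓ n • |w|) (y ⊓ |z|)
    rw [h1, zero_add] at h2
    rw [← h2]
    exact sup_le (hle n) inf_le_left
  · intro s hs
    rw [Set.mem_singleton_iff.1 hs, abs_of_nonneg (sub_nonneg.2 hyx)]
    have h0 : 0 ≤ (x - y) ⊓ |w| := le_inf (sub_nonneg.2 hyx) (abs_nonneg w)
    refine le_antisymm ?_ h0
    -- Adding `(x - y) ⊓ |w|` to the `n`-th truncation gives at most the truncation at level `n +
    -- 1`, hence at most `y`.
    rw [← le_sub_self_iff y]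
    refine ciSup_le fun n => ?_
    rw [le_sub_iff_add_le]
    refine le_trans (le_inf ?_ ?_) (hle (n + 1))
    · calc _ ≤ y + (x - y) := add_le_add (hle n) inf_le_left
        _ = x := by abel
    · rw [succ_nsmul]
      exact add_le_add inf_le_right inf_le_right

theorem isCompl_disjointComplement (w : E) :
    IsCompl (disjointComplement (disjointComplement {w} : Set E)) (disjointComplement {w}) := by
  constructor
  · rw [Submodule.disjoint_def]
    intro x hx hx'
    have := hx x hx'
    rw [inf_idem] at this
    exact eq_zero_of_abs_le_zero this.le
  · rw [codisjoint_iff, Submodule.eq_top_iff']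
    have key : ∀ x : E, 0 ≤ x → x ∈ disjointComplement (disjointComplement {w} : Set E) ⊔
        disjointComplement {w} := fun x hx => by
      obtain ⟨y, -, -, h1, h2⟩ := exists_band_decomposition w hx
      rw [← add_sub_cancel y x]
      exact Submodule.add_mem_sup h1 h2
    intro x
    rw [← posPart_sub_negPart x]
    exact Submodule.sub_mem _ (key _ (posPart_nonneg x)) (key _ (negPart_nonneg x))

/-- Every element of a Dedekind complete Riesz space is split by a band projection into a
positive and a negative part. -/
theorem exists_isBandProjection (z : E) :
    ∃ π : E →ₗ[ℝ] E, IsBandProjection π ∧ 0 ≤ π z ∧ z ≤ π z := by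
  -- The projection sought is the one onto the band generated by `z⁺`; it kills `z⁻` and so sends
  -- `z` to `z⁺`.
  have hc := isCompl_disjointComplement z⁺
  set B := disjointComplement (disjointComplement {z⁺} : Set E)
  set C := disjointComplement {z⁺}
  have hadd : ∀ y ∈ B, ∀ y' ∈ C, B.projection C hc (y + y') = y := fun y hy y' hy' => by
    rw [map_add, Submodule.projection_apply_of_mem_left hc hy,
      Submodule.projection_apply_of_mem_right hc hy', add_zero]
  have hpos : ∀ x, 0 ≤ x → 0 ≤ B.projection C hc x ∧ B.projection C hc x ≤ x := fun x hx => by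
    obtain ⟨y, h0, h1, h2, h3⟩ := exists_band_decomposition z⁺ hx
    have := hadd y h2 _ h3
    rw [add_sub_cancel] at this
    rw [this]
    exact ⟨h0, h1⟩
  have hz : B.projection C hc z = z⁺ := by
    have := hadd z⁺ (fun s hs => by rw [inf_comm]; exact hs _ rfl) (-z⁻) (by
      rintro _ rfl
      rw [abs_neg, abs_of_nonneg (negPart_nonneg z), abs_of_nonneg (posPart_nonneg z), inf_comm]
      exact posPart_inf_negPart_eq_zero z)
    rwa [← sub_eq_add_neg, posPart_sub_negPart] at this
  refine ⟨B.projection C hc, ⟨fun x hx => (hpos x hx).1, fun x hx => (hpos x hx).2,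
    fun x => ?_⟩, ?_, ?_⟩
  · exact Submodule.projection_apply_of_mem_left hc (Submodule.projection_apply_mem hc x)
  · rw [hz]; exact posPart_nonneg z
  · rw [hz]; exact le_posPart z

end Dedekind

/-! ### Finite band partitions -/

section Partition

variable {E : Type*} [AddCommGroup E] [Lattice E] [IsOrderedAddMonoid E] [Module ℝ E]
  [IsOrderedModule ℝ E]

/-- A finite family of mutually disjoint band projections with sum the identity. -/
structure IsBandPartition {ι : Type*} [Fintype ι] (π : ι → E →ₗ[ℝ] E) : Prop where
  isBandProjection : ∀ i, IsBandProjection (π i)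
  disjoint : ∀ i j, i ≠ j → ∀ x, π i (π j x) = 0
  sum_eq : ∀ x, ∑ i, π i x = x

namespace IsBandPartition

variable {ι κ : Type*} [Fintype ι] [Fintype κ] {π : ι → E →ₗ[ℝ] E} {ρ : κ → E →ₗ[ℝ] E}

theorem inf_eq_zero (h : IsBandPartition π) {i j : ι} (hij : i ≠ j) {x : E} (hx : 0 ≤ x) :
    π i x ⊓ π j x = 0 := by
  have h1 := (h.isBandProjection i).disjoint hx ((h.isBandProjection j).nonneg x hx)
  rwa [h.disjoint i j hij, sub_zero] at h1

theorem prod (h : IsBandPartition π) (h' : IsBandPartition ρ) :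
    IsBandPartition fun k : ι × κ => π k.1 ∘ₗ ρ k.2 where
  isBandProjection k := (h.isBandProjection k.1).comp (h'.isBandProjection k.2)
  disjoint k l hkl x := by
    simp only [LinearMap.comp_apply]
    rw [← (h.isBandProjection l.1).comm (h'.isBandProjection k.2)]
    by_cases h1 : k.1 = l.1
    · have h2 : k.2 ≠ l.2 := fun h2 => hkl (Prod.ext h1 h2)
      rw [h'.disjoint _ _ h2, map_zero, map_zero]
    · rw [h.disjoint _ _ h1]
  sum_eq x := by
    simp only [LinearMap.comp_apply]
    rw [Fintype.sum_prod_type]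
    simp only [← map_sum, h'.sum_eq, h.sum_eq]

theorem bool {σ : E →ₗ[ℝ] E} (h : IsBandProjection σ) :
    IsBandPartition fun b : Bool => if b then σ else LinearMap.id - σ where
  isBandProjection b := by
    cases b
    · exact h.compl
    · exact h
  disjoint b c hbc x := by
    cases b <;> cases c <;> simp_all [h.idem]
  sum_eq x := by simp

end IsBandPartition

end Partition

/-! ### Freudenthal approximation on partitions -/

section DedekindPartition

variable {E : Type*} [AddCommGroup E] [ConditionallyCompleteLattice E] [IsOrderedAddMonoid E]
  [Module ℝ E] [IsOrderedModule ℝ E]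

/-- Finitely many elements of a Dedekind complete Riesz space have constant sign on the pieces of a
suitable band partition. -/
theorem exists_isBandPartition_sign (L : List E) :
    ∃ (ι : Type) (_ : Fintype ι) (π : ι → E →ₗ[ℝ] E), IsBandPartition π ∧
      ∀ z ∈ L, ∀ i, 0 ≤ π i z ∨ π i z ≤ 0 := by
  induction L with
  | nil =>
    refine ⟨Unit, inferInstance, fun _ => LinearMap.id, ⟨fun _ => .id, fun i j h => ?_, ?_⟩, ?_⟩
    · exact absurd rfl h
    · simp
    · simp
  | cons z L ih =>
    obtain ⟨ι, _, π, hπ, hL⟩ := ih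
    obtain ⟨σ, hσ, h1, h2⟩ := exists_isBandProjection z
    -- Signs already decided survive refinement, since band projections are positive.
    refine ⟨Bool × ι, inferInstance, _, (IsBandPartition.bool hσ).prod hπ, fun y hy k => ?_⟩
    obtain ⟨b, i⟩ := k
    rcases List.mem_cons.1 hy with rfl | hy
    · have hb := (IsBandPartition.bool hσ).isBandProjection b
      have hi := hπ.isBandProjection i
      simp only [LinearMap.comp_apply]
      rw [hb.comm hi]
      cases b
      · right
        rw [← map_zero (π i)]
        exact hi.mono (by simpa using h2)
      · left
        exact hi.nonneg _ (by simpa using h1)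
    · have hb := (IsBandPartition.bool hσ).isBandProjection b
      rcases hL y hy i with h | h
      · exact Or.inl (hb.nonneg _ h)
      · right
        simpa using hb.mono h

/-- Freudenthal: finitely many elements of `[-a, a]` are uniformly approximated by multiples of `a`
on the pieces of a suitable band partition. -/
theorem exists_isBandPartition_approx (L : List E) {a : E} (hL : ∀ x ∈ L, |x| ≤ a) (m : ℕ) :
    ∃ (ι : Type) (_ : Fintype ι) (π : ι → E →ₗ[ℝ] E), IsBandPartition π ∧
      ∀ i, ∀ x ∈ L, ∃ c : ℝ, |c| ≤ 1 ∧ |π i x - c • π i a| ≤ ((m : ℝ) + 1)⁻¹ • π i a := by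
  -- A grid on `[-1, 1]` with spacing `1 / (m + 1)`. Deciding the signs of all `x - r k • a` places
  -- `x` on each piece relative to every level; the top level is omitted because `x ≤ a` already.
  set r : ℕ → ℝ := fun k => -1 + k * ((m : ℝ) + 1)⁻¹ with hr
  have hm : (0 : ℝ) < (m : ℝ) + 1 := by positivity
  obtain ⟨ι, hι, π, hπ, hsign⟩ := exists_isBandPartition_sign
    (L.flatMap fun x => (List.range (2 * (m + 1))).map fun k => x - r k • a)
  refine ⟨ι, hι, π, hπ, fun i x hx => ?_⟩
  have hi := hπ.isBandProjection i
  have ha : 0 ≤ a := (abs_nonneg x).trans (hL x hx)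
  have hia := hi.nonneg a ha
  obtain ⟨hxa, hxa'⟩ := abs_le'.1 (hL x hx)
  have hs : ∀ k < 2 * (m + 1), r k • π i a ≤ π i x ∨ π i x ≤ r k • π i a := fun k hk => by
    have := hsign (x - r k • a) (List.mem_flatMap.2 ⟨x, hx, List.mem_map.2
      ⟨k, List.mem_range.2 hk, rfl⟩⟩) i
    rwa [map_sub, map_smul, sub_nonneg, sub_nonpos] at this
  have hr0 : r 0 = -1 := by simp [hr]
  have hr2 : r (2 * (m + 1)) = 1 := by simp only [hr]; push_cast; field_simp; ring
  have hrs : ∀ k, r (k + 1) = r k + ((m : ℝ) + 1)⁻¹ := fun k => by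
    simp only [hr]; push_cast; ring
  have hrr : ∀ k ≤ 2 * (m + 1), |r k| ≤ 1 := fun k hk => by
    have h1 : (k : ℝ) ≤ 2 * (m + 1) := by exact_mod_cast hk
    have h2 : (k : ℝ) * ((m : ℝ) + 1)⁻¹ ≤ 2 := by
      rw [← div_eq_mul_inv, div_le_iff₀ hm]; exact h1
    have h3 : 0 ≤ (k : ℝ) * ((m : ℝ) + 1)⁻¹ := by positivity
    rw [abs_le]
    simp only [hr]
    constructor <;> linarith
  have hlow : r 0 • π i a ≤ π i x := by
    rw [hr0, neg_one_smul, neg_le, ← map_neg]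
    exact hi.mono hxa'
  have hup : π i x ≤ r (2 * (m + 1)) • π i a := by
    rw [hr2, one_smul]
    exact hi.mono hxa
  -- Discrete intermediate value argument: if `π i x` never fell between consecutive levels, it
  -- would stay above all of them up to the last, where `hup` is contradicted.
  obtain ⟨k, hk, h1, h2⟩ : ∃ k < 2 * (m + 1), r k • π i a ≤ π i x ∧
      π i x ≤ r (k + 1) • π i a := by
    by_contra! hcon
    have : ∀ k ≤ 2 * (m + 1), r k • π i a ≤ π i x := fun k => by
      induction k with
      | zero => exact fun _ => hlow
      | succ k ih =>
        intro hk
        have h1 := hcon k hk (ih (Nat.le_of_succ_le hk))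
        rcases hk.lt_or_eq with h2 | h2
        · exact (hs _ h2).resolve_right h1
        · exact absurd (h2 ▸ hup) h1
    have h3 := hcon (2 * m + 1) (by omega) (this _ (by omega))
    exact h3 hup
  refine ⟨r k, hrr k hk.le, abs_le'.2 ⟨?_, ?_⟩⟩
  · rw [sub_le_iff_le_add, ← add_smul, add_comm, ← hrs]
    exact h2
  · rw [neg_sub]
    exact (sub_nonpos.2 h1).trans (smul_nonneg (by positivity) hia)

end DedekindPartition

end RieszSpace

/-! ### Riesz bimorphisms and injectivity on the Fremlin tensor product -/

namespace IsRieszBimorphism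

open RieszSpace

variable {E F G : Type*}
  [AddCommGroup E] [Lattice E] [IsOrderedAddMonoid E] [Module ℝ E]
  [AddCommGroup F] [Lattice F] [IsOrderedAddMonoid F] [Module ℝ F]
  [AddCommGroup G] [Lattice G] [IsOrderedAddMonoid G] [Module ℝ G]
  {φ : E →ₗ[ℝ] F →ₗ[ℝ] G}

theorem nonneg (h : IsRieszBimorphism φ) {x : E} {y : F} (hx : 0 ≤ x) (hy : 0 ≤ y) :
    0 ≤ φ x y := by
  have h1 := h.sup_right x y 0 hx
  rw [sup_eq_left.2 hy, map_zero] at h1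
  rw [h1]
  exact le_sup_right

theorem mono_left (h : IsRieszBimorphism φ) {x x' : E} {y : F} (hx : x ≤ x') (hy : 0 ≤ y) :
    φ x y ≤ φ x' y := by
  have h1 := h.nonneg (sub_nonneg.2 hx) hy
  rwa [map_sub, LinearMap.sub_apply, sub_nonneg] at h1

theorem mono_right (h : IsRieszBimorphism φ) {x : E} {y y' : F} (hx : 0 ≤ x) (hy : y ≤ y') :
    φ x y ≤ φ x y' := by
  have h1 := h.nonneg hx (sub_nonneg.2 hy)
  rwa [map_sub, sub_nonneg] at h1

theorem inf_left (h : IsRieszBimorphism φ) (x x' : E) {y : F} (hy : 0 ≤ y) :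
    φ (x ⊓ x') y = φ x y ⊓ φ x' y := by
  have h1 := congrArg (fun z => φ z y) (inf_add_sup x x')
  simp only [map_add, LinearMap.add_apply, h.sup_left x x' y hy] at h1
  rw [← inf_add_sup (φ x y)] at h1
  exact add_right_cancel h1

theorem inf_right (h : IsRieszBimorphism φ) {x : E} (hx : 0 ≤ x) (y y' : F) :
    φ x (y ⊓ y') = φ x y ⊓ φ x y' := by
  have h1 := congrArg (φ x) (inf_add_sup y y')
  simp only [map_add, h.sup_right x y y' hx] at h1
  rw [← inf_add_sup (φ x y)] at h1
  exact add_right_cancel h1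

theorem abs_left (h : IsRieszBimorphism φ) (x : E) {y : F} (hy : 0 ≤ y) :
    |φ x y| = φ |x| y := by
  rw [abs, abs, h.sup_left _ _ _ hy, map_neg, LinearMap.neg_apply]

theorem abs_right (h : IsRieszBimorphism φ) {x : E} (hx : 0 ≤ x) (y : F) :
    |φ x y| = φ x |y| := by
  rw [abs, abs, h.sup_right _ _ _ hx, map_neg]

theorem abs_le (h : IsRieszBimorphism φ) (x : E) (y : F) : |φ x y| ≤ φ |x| |y| := by
  conv_lhs => rw [← posPart_sub_negPart y, map_sub, sub_eq_add_neg]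
  refine (abs_add_le _ _).trans_eq ?_
  rw [abs_neg, h.abs_left x (posPart_nonneg y), h.abs_left x (negPart_nonneg y), ← map_add,
    posPart_add_negPart]

theorem abs_le_of_le (h : IsRieszBimorphism φ) {x a : E} {y b : F} (hx : |x| ≤ a)
    (hy : |y| ≤ b) : |φ x y| ≤ φ a b :=
  (h.abs_le x y).trans ((h.mono_left hx (abs_nonneg y)).trans
    (h.mono_right ((abs_nonneg x).trans hx) hy))

/-- Restricting to a piece of a product partition keeps a bimorphism, since band projections are
lattice homomorphisms; estimates valid for all bimorphisms can thus be applied piece by piece. -/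
theorem compl₁₂ [IsOrderedModule ℝ E] [IsOrderedModule ℝ F] (h : IsRieszBimorphism φ)
    {π : E →ₗ[ℝ] E} {ρ : F →ₗ[ℝ] F} (hπ : IsBandProjection π) (hρ : IsBandProjection ρ) :
    IsRieszBimorphism (φ.compl₁₂ π ρ) where
  sup_right x y y' hx := by
    simp only [LinearMap.compl₁₂_apply]
    rw [hρ.map_sup, h.sup_right _ _ _ (hπ.nonneg x hx)]
  sup_left x x' y hy := by
    simp only [LinearMap.compl₁₂_apply]
    rw [hπ.map_sup, h.sup_left _ _ _ (hρ.nonneg y hy)]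

end IsRieszBimorphism

/-! ### Expressions evaluated along bimorphisms -/

namespace FremlinTensor

open RieszSpace

section Term

variable {E F : Type*}

/-- The left factors occurring in an expression. -/
def Term.lefts : Term E F → List E
  | .tmul x _ => [x]
  | .zero => []
  | .add s t | .sup s t | .inf s t => s.lefts ++ t.lefts
  | .smul _ s => s.lefts

/-- The right factors occurring in an expression. -/
def Term.rights : Term E F → List F
  | .tmul _ y => [y]
  | .zero => []
  | .add s t | .sup s t | .inf s t => s.rights ++ t.rights
  | .smul _ s => s.rights

end Term

section Eval

variable {E F G : Type*}
  [AddCommGroup E] [Lattice E] [IsOrderedAddMonoid E] [Module ℝ E]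
  [AddCommGroup F] [Lattice F] [IsOrderedAddMonoid F] [Module ℝ F]
  [AddCommGroup G] [Lattice G] [IsOrderedAddMonoid G] [Module ℝ G] [IsOrderedModule ℝ G]

/-- The point is that `N` depends on the expression but not on `φ`: one constant serves all
restrictions to pieces, as the lemmas on disjoint sums require. -/
theorem exists_abs_eval_le (s : Term E F) {a : E} {b : F} (ha : 0 ≤ a) (hb : 0 ≤ b)
    (hl : ∀ x ∈ s.lefts, |x| ≤ a) (hr : ∀ y ∈ s.rights, |y| ≤ b) :
    ∃ N : ℕ, ∀ φ : E →ₗ[ℝ] F →ₗ[ℝ] G, IsRieszBimorphism φ → |eval φ s| ≤ N • φ a b := by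
  have binary : ∀ s t : Term E F,
      (∃ N : ℕ, ∀ φ : E →ₗ[ℝ] F →ₗ[ℝ] G, IsRieszBimorphism φ → |eval φ s| ≤ N • φ a b) →
      (∃ N : ℕ, ∀ φ : E →ₗ[ℝ] F →ₗ[ℝ] G, IsRieszBimorphism φ → |eval φ t| ≤ N • φ a b) →
      ∃ N : ℕ, ∀ φ : E →ₗ[ℝ] F →ₗ[ℝ] G, IsRieszBimorphism φ →
        |eval φ s| + |eval φ t| ≤ N • φ a b := by
    rintro s t ⟨M, hM⟩ ⟨N, hN⟩
    exact ⟨M + N, fun φ hφ => by rw [add_smul]; exact add_le_add (hM φ hφ) (hN φ hφ)⟩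
  induction s with
  | tmul x y =>
    refine ⟨1, fun φ hφ => ?_⟩
    rw [one_smul]
    exact hφ.abs_le_of_le (hl x (by simp [Term.lefts])) (hr y (by simp [Term.rights]))
  | zero => exact ⟨0, fun φ _ => by simp [eval]⟩
  | smul c s ih =>
    obtain ⟨N, hN⟩ := ih hl hr
    refine ⟨⌈|c|⌉₊ * N, fun φ hφ => ?_⟩
    rw [eval, abs_smul_eq, mul_smul]
    exact (smul_le_smul_of_nonneg_left (hN φ hφ) (abs_nonneg c)).trans
      (le_nsmul_of_smul (nsmul_nonneg (hφ.nonneg ha hb) N) _)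
  | add s t hs ht =>
    simp only [Term.lefts, Term.rights, List.mem_append, or_imp, forall_and] at hl hr
    obtain ⟨N, hN⟩ := binary s t (hs hl.1 hr.1) (ht hl.2 hr.2)
    exact ⟨N, fun φ hφ => (abs_add_le _ _).trans (hN φ hφ)⟩
  | sup s t hs ht =>
    simp only [Term.lefts, Term.rights, List.mem_append, or_imp, forall_and] at hl hr
    obtain ⟨N, hN⟩ := binary s t (hs hl.1 hr.1) (ht hl.2 hr.2)
    exact ⟨N, fun φ hφ => (abs_sup_le (le_add_of_nonneg_right (abs_nonneg _))
      (le_add_of_nonneg_left (abs_nonneg _))).trans (hN φ hφ)⟩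
  | inf s t hs ht =>
    simp only [Term.lefts, Term.rights, List.mem_append, or_imp, forall_and] at hl hr
    obtain ⟨N, hN⟩ := binary s t (hs hl.1 hr.1) (ht hl.2 hr.2)
    exact ⟨N, fun φ hφ => (abs_inf_le (le_add_of_nonneg_right (abs_nonneg _))
      (le_add_of_nonneg_left (abs_nonneg _))).trans (hN φ hφ)⟩

/-- If along `φ` all left factors are within `ε` of multiples of `a`, and all right factors within
`ε` of multiples of `b`, then the value is close to a multiple of `φ a b`. -/
theorem exists_abs_eval_sub_smul_le (s : Term E F) {a : E} {b : F} (ha : 0 ≤ a) (hb : 0 ≤ b)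
    (hr : ∀ y ∈ s.rights, |y| ≤ b) :
    ∃ C : ℝ, 0 ≤ C ∧ ∀ (φ : E →ₗ[ℝ] F →ₗ[ℝ] G) (ε : ℝ), IsRieszBimorphism φ → 0 ≤ ε →
      (∀ x ∈ s.lefts, ∃ c : ℝ, |c| ≤ 1 ∧ φ |x - c • a| b ≤ ε • φ a b) →
      (∀ y ∈ s.rights, ∃ d : ℝ, |d| ≤ 1 ∧ φ a |y - d • b| ≤ ε • φ a b) →
      ∃ c : ℝ, |eval φ s - c • φ a b| ≤ (C * ε) • φ a b := by
  induction s with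
  | tmul x y =>
    -- One error `ε` for each factor: `x` is replaced by `c • a` first, then `y` by `d • b`, where
    -- `|c| ≤ 1` keeps the second error at `ε`.
    refine ⟨2, by norm_num, fun φ ε hφ hε hx hy => ?_⟩
    obtain ⟨c, hc, hxc⟩ := hx x (by simp [Term.lefts])
    obtain ⟨d, hd, hyd⟩ := hy y (by simp [Term.rights])
    refine ⟨c * d, ?_⟩
    have h1 : φ x y - (c * d) • φ a b = φ (x - c • a) y + c • φ a (y - d • b) := by
      simp only [map_sub, map_smul, LinearMap.sub_apply, LinearMap.smul_apply, smul_sub, mul_smul]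
      abel
    have h2 : |φ (x - c • a) y| ≤ ε • φ a b :=
      (hφ.abs_le_of_le le_rfl (hr y (by simp [Term.rights]))).trans hxc
    have h3 : |c • φ a (y - d • b)| ≤ ε • φ a b := by
      rw [abs_smul_eq, hφ.abs_right ha]
      refine (smul_le_smul_of_nonneg_right hc (hφ.nonneg ha (abs_nonneg _))).trans ?_
      rwa [one_smul]
    rw [eval, h1, two_mul, add_smul]
    exact (abs_add_le _ _).trans (add_le_add h2 h3)
  | zero => exact ⟨0, le_rfl, fun φ ε _ _ _ _ => ⟨0, by simp [eval]⟩⟩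
  | smul r s ih =>
    obtain ⟨C, hC, h⟩ := ih hr
    refine ⟨|r| * C, by positivity, fun φ ε hφ hε hx hy => ?_⟩
    obtain ⟨c, hc⟩ := h φ ε hφ hε hx hy
    refine ⟨r * c, ?_⟩
    rw [eval, mul_smul, ← smul_sub, abs_smul_eq, mul_assoc, mul_smul |r|]
    exact smul_le_smul_of_nonneg_left hc (abs_nonneg r)
  | add s t hs ht =>
    simp only [Term.rights, List.mem_append, or_imp, forall_and] at hr
    obtain ⟨C, hC, h⟩ := hs hr.1
    obtain ⟨D, hD, h'⟩ := ht hr.2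
    refine ⟨C + D, by positivity, fun φ ε hφ hε hx hy => ?_⟩
    simp only [Term.lefts, Term.rights, List.mem_append, or_imp, forall_and] at hx hy
    obtain ⟨c, hc⟩ := h φ ε hφ hε hx.1 hy.1
    obtain ⟨d, hd⟩ := h' φ ε hφ hε hx.2 hy.2
    refine ⟨c + d, ?_⟩
    rw [eval, add_smul, add_mul, add_smul, add_sub_add_comm]
    exact (abs_add_le _ _).trans (add_le_add hc hd)
  | sup s t hs ht =>
    simp only [Term.rights, List.mem_append, or_imp, forall_and] at hr
    obtain ⟨C, hC, h⟩ := hs hr.1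
    obtain ⟨D, hD, h'⟩ := ht hr.2
    refine ⟨C + D, by positivity, fun φ ε hφ hε hx hy => ?_⟩
    simp only [Term.lefts, Term.rights, List.mem_append, or_imp, forall_and] at hx hy
    obtain ⟨c, hc⟩ := h φ ε hφ hε hx.1 hy.1
    obtain ⟨d, hd⟩ := h' φ ε hφ hε hx.2 hy.2
    -- Multiples of the positive element `φ a b` are ordered as their coefficients, so their
    -- supremum is again a multiple.
    refine ⟨c ⊔ d, ?_⟩
    rw [eval, sup_smul_of_nonneg (hφ.nonneg ha hb), add_mul, add_smul]
    exact (abs_sup_sub_sup_le_add _ _ _ _).trans (add_le_add hc hd)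
  | inf s t hs ht =>
    simp only [Term.rights, List.mem_append, or_imp, forall_and] at hr
    obtain ⟨C, hC, h⟩ := hs hr.1
    obtain ⟨D, hD, h'⟩ := ht hr.2
    refine ⟨C + D, by positivity, fun φ ε hφ hε hx hy => ?_⟩
    simp only [Term.lefts, Term.rights, List.mem_append, or_imp, forall_and] at hx hy
    obtain ⟨c, hc⟩ := h φ ε hφ hε hx.1 hy.1
    obtain ⟨d, hd⟩ := h' φ ε hφ hε hx.2 hy.2
    refine ⟨c ⊓ d, ?_⟩
    rw [eval, inf_smul_of_nonneg (hφ.nonneg ha hb), add_mul, add_smul]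
    exact (abs_inf_sub_inf_le_add _ _ _ _).trans (add_le_add hc hd)

end Eval

/-! ### Decomposition of tensors along product partitions -/

section Partition

variable {E F : Type*}
  [AddCommGroup E] [Lattice E] [IsOrderedAddMonoid E] [Module ℝ E] [IsOrderedModule ℝ E]
  [AddCommGroup F] [Lattice F] [IsOrderedAddMonoid F] [Module ℝ F] [IsOrderedModule ℝ F]
  {ι κ : Type*} [Fintype ι] [Fintype κ] {π : ι → E →ₗ[ℝ] E} {ρ : κ → F →ₗ[ℝ] F}

/-- Distinct index pairs differ in some coordinate, and disjointness in one factor suffices; when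
the left factors are the disjoint ones, both right factors are first enlarged to `b`. -/
theorem tmul_inf_eq_zero (hπ : IsBandPartition π) (hρ : IsBandPartition ρ) {a : E} {b : F}
    (ha : 0 ≤ a) (hb : 0 ≤ b) {k l : ι × κ} (hkl : k ≠ l) :
    tmul E F (π k.1 a) (ρ k.2 b) ⊓ tmul E F (π l.1 a) (ρ l.2 b) = 0 := by
  have hφ := tmul_isRieszBimorphism (E := E) (F := F)
  have ha' := fun i => (hπ.isBandProjection i).nonneg a ha
  have hb' := fun j => (hρ.isBandProjection j).nonneg b hb
  by_cases h1 : k.1 = l.1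
  · have h2 : k.2 ≠ l.2 := fun h2 => hkl (Prod.ext h1 h2)
    rw [h1, ← hφ.inf_right (ha' _), hρ.inf_eq_zero h2 hb, map_zero]
  · refine inf_eq_zero_of_le (hφ.nonneg (ha' _) (hb' _)) (hφ.nonneg (ha' _) (hb' _))
      (hφ.mono_right (ha' _) ((hρ.isBandProjection _).le_self b hb))
      (hφ.mono_right (ha' _) ((hρ.isBandProjection _).le_self b hb)) ?_
    rw [← hφ.inf_left _ _ hb, hπ.inf_eq_zero h1 ha, map_zero, LinearMap.zero_apply]

theorem sum_tmul (hπ : IsBandPartition π) (hρ : IsBandPartition ρ) (x : E) (y : F) :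
    ∑ k : ι × κ, tmul E F (π k.1 x) (ρ k.2 y) = tmul E F x y := by
  rw [Fintype.sum_prod_type]
  simp only [← map_sum, hρ.sum_eq]
  simp only [← LinearMap.sum_apply, ← map_sum, hπ.sum_eq]

/-- Every element is the sum of its restrictions to the pieces of a product partition. -/
theorem sum_eval (hπ : IsBandPartition π) (hρ : IsBandPartition ρ) (s : Term E F) {a : E} {b : F}
    (ha : 0 ≤ a) (hb : 0 ≤ b) (hl : ∀ x ∈ s.lefts, |x| ≤ a) (hr : ∀ y ∈ s.rights, |y| ≤ b) :
    ∑ k : ι × κ, eval ((tmul E F).compl₁₂ (π k.1) (ρ k.2)) s = mk s := by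
  have hφ := tmul_isRieszBimorphism (E := E) (F := F)
  have hd : ∀ k : ι × κ, 0 ≤ tmul E F (π k.1 a) (ρ k.2 b) := fun k =>
    hφ.nonneg ((hπ.isBandProjection _).nonneg a ha) ((hρ.isBandProjection _).nonneg b hb)
  have bound : ∀ s t : Term E F, (∀ x ∈ s.lefts, |x| ≤ a) → (∀ y ∈ s.rights, |y| ≤ b) →
      (∀ x ∈ t.lefts, |x| ≤ a) → (∀ y ∈ t.rights, |y| ≤ b) → ∃ N : ℕ,
      (∀ k : ι × κ, |eval ((tmul E F).compl₁₂ (π k.1) (ρ k.2)) s| ≤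
        N • tmul E F (π k.1 a) (ρ k.2 b)) ∧
      ∀ k : ι × κ, |eval ((tmul E F).compl₁₂ (π k.1) (ρ k.2)) t| ≤
        N • tmul E F (π k.1 a) (ρ k.2 b) := fun s t hs hs' ht ht' => by
    obtain ⟨M, hM⟩ := exists_abs_eval_le (G := FremlinTensorProduct E F) s ha hb hs hs'
    obtain ⟨N, hN⟩ := exists_abs_eval_le (G := FremlinTensorProduct E F) t ha hb ht ht'
    have hφk := fun k : ι × κ =>
      hφ.compl₁₂ (hπ.isBandProjection k.1) (hρ.isBandProjection k.2)
    exact ⟨M + N,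
      fun k => (hM _ (hφk k)).trans (nsmul_le_nsmul_left (hd k) (Nat.le_add_right M N)),
      fun k => (hN _ (hφk k)).trans (nsmul_le_nsmul_left (hd k) (Nat.le_add_left N M))⟩
  induction s with
  | tmul x y => exact sum_tmul hπ hρ x y
  | zero => simp only [eval, Finset.sum_const_zero]; rfl
  | smul c s ih => rw [mk_smul, ← ih hl hr, Finset.smul_sum]; rfl
  | add s t hs ht =>
    simp only [Term.lefts, Term.rights, List.mem_append, or_imp, forall_and] at hl hr
    rw [mk_add, ← hs hl.1 hr.1, ← ht hl.2 hr.2, ← Finset.sum_add_distrib]; rfl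
  | sup s t hs ht =>
    simp only [Term.lefts, Term.rights, List.mem_append, or_imp, forall_and] at hl hr
    obtain ⟨N, h, h'⟩ := bound s t hl.1 hr.1 hl.2 hr.2
    rw [mk_sup, ← hs hl.1 hr.1, ← ht hl.2 hr.2, sum_sup_sum_of_disjoint hd
      (fun k l hkl => tmul_inf_eq_zero hπ hρ ha hb hkl) N h h']
    rfl
  | inf s t hs ht =>
    simp only [Term.lefts, Term.rights, List.mem_append, or_imp, forall_and] at hl hr
    obtain ⟨N, h, h'⟩ := bound s t hl.1 hr.1 hl.2 hr.2
    rw [mk_inf, ← hs hl.1 hr.1, ← ht hl.2 hr.2, sum_inf_sum_of_disjoint hd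
      (fun k l hkl => tmul_inf_eq_zero hπ hρ ha hb hkl) N h h']
    rfl

end Partition

/-! ### Injectivity of faithful Riesz homomorphisms -/

section Injective

variable {E F H : Type*}
  [AddCommGroup E] [ConditionallyCompleteLattice E] [IsOrderedAddMonoid E] [Module ℝ E]
  [IsOrderedModule ℝ E]
  [AddCommGroup F] [ConditionallyCompleteLattice F] [IsOrderedAddMonoid F] [Module ℝ F]
  [IsOrderedModule ℝ F]
  [AddCommGroup H] [Lattice H] [IsOrderedAddMonoid H] [Module ℝ H] [IsOrderedModule ℝ H]

theorem exists_upper_bound {E : Type*} [AddCommGroup E] [Lattice E] [IsOrderedAddMonoid E]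
    (L : List E) : ∃ a : E, 0 ≤ a ∧ ∀ x ∈ L, |x| ≤ a := by
  induction L with
  | nil => exact ⟨0, le_rfl, by simp⟩
  | cons y L ih =>
    obtain ⟨a, ha, h⟩ := ih
    refine ⟨|y| ⊔ a, ha.trans le_sup_right, fun x hx => ?_⟩
    rcases List.mem_cons.1 hx with rfl | hx
    · exact le_sup_left
    · exact (h x hx).trans le_sup_right

/-- A Riesz homomorphism on the Fremlin tensor product of Dedekind complete Riesz spaces that is
nonzero on nonzero positive elementary tensors is injective. -/
theorem eq_zero_of_map_eq_zero (T : FremlinTensorProduct E F →ₗ[ℝ] H)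
    (hT : ∀ a b, T (a ⊔ b) = T a ⊔ T b)
    (hT' : ∀ x y, 0 ≤ x → 0 ≤ y → T (tmul E F x y) = 0 → x = 0 ∨ y = 0)
    (h : FremlinTensorProduct E F) (hh : T h = 0) : h = 0 := by
  induction h using ind with | h s =>
  have hφ := tmul_isRieszBimorphism (E := E) (F := F)
  have hTabs : ∀ g, T |g| = |T g| := fun g => by rw [abs, abs, hT, map_neg]
  have hT0 : ∀ g, 0 ≤ g → 0 ≤ T g := fun g hg => by
    have := hT g 0
    rw [sup_eq_left.2 hg, map_zero] at this
    rw [this]; exact le_sup_right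
  have hTmono : ∀ g g', g ≤ g' → T g ≤ T g' := fun g g' hg => by
    have := hT0 _ (sub_nonneg.2 hg)
    rwa [map_sub, sub_nonneg] at this
  obtain ⟨a, ha, hl⟩ := exists_upper_bound s.lefts
  obtain ⟨b, hb, hr⟩ := exists_upper_bound s.rights
  obtain ⟨N, hN⟩ := exists_abs_eval_le (G := FremlinTensorProduct E F) s ha hb hl hr
  obtain ⟨C, hC, happrox⟩ :=
    exists_abs_eval_sub_smul_le (G := FremlinTensorProduct E F) s ha hb hr
  refine eq_zero_of_abs_le_zero (le_zero_of_forall_le_smul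
    (y := (2 * C) • tmul E F a b) (smul_nonneg (by positivity) (hφ.nonneg ha hb)) fun m => ?_)
  obtain ⟨ι, _, π, hπ, hπl⟩ := exists_isBandPartition_approx s.lefts hl m
  obtain ⟨κ, _, ρ, hρ, hρr⟩ := exists_isBandPartition_approx s.rights hr m
  set ε : ℝ := ((m : ℝ) + 1)⁻¹ with hε
  have hε0 : 0 ≤ ε := by positivity
  set φ := fun k : ι × κ => (tmul E F).compl₁₂ (π k.1) (ρ k.2)
  set D := fun k : ι × κ => tmul E F (π k.1 a) (ρ k.2 b)
  have hπa : ∀ i, 0 ≤ π i a := fun i => (hπ.isBandProjection i).nonneg a ha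
  have hρb : ∀ j, 0 ≤ ρ j b := fun j => (hρ.isBandProjection j).nonneg b hb
  have hD0 : ∀ k, 0 ≤ D k := fun k => hφ.nonneg (hπa k.1) (hρb k.2)
  have hφk : ∀ k, IsRieszBimorphism (φ k) := fun k =>
    hφ.compl₁₂ (hπ.isBandProjection k.1) (hρ.isBandProjection k.2)
  have hbound : ∀ k, |eval (φ k) s| ≤ N • D k := fun k => hN _ (hφk k)
  have hsum : |mk s| = ∑ k, |eval (φ k) s| := by
    rw [← sum_eval hπ hρ s ha hb hl hr]
    exact abs_sum_of_disjoint hD0 (fun k l hkl => tmul_inf_eq_zero hπ hρ ha hb hkl) N hbound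
  have hpiece : ∀ k, |eval (φ k) s| ≤ (2 * C * ε) • D k := fun k => by
    obtain ⟨c, hc⟩ : ∃ c : ℝ, |eval (φ k) s - c • D k| ≤ (C * ε) • D k := by
      refine happrox (φ k) ε (hφk k) hε0 (fun x hx => ?_) fun y hy => ?_
      · obtain ⟨c, hc, hxc⟩ := hπl k.1 x hx
        refine ⟨c, hc, ?_⟩
        change tmul E F (π k.1 |x - c • a|) (ρ k.2 b) ≤ ε • tmul E F (π k.1 a) (ρ k.2 b)
        rw [← (hπ.isBandProjection k.1).map_abs, map_sub, (π k.1).map_smul]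
        refine (hφ.mono_left hxc (hρb k.2)).trans_eq ?_
        rw [map_smul, LinearMap.smul_apply]
      · obtain ⟨d, hd, hyd⟩ := hρr k.2 y hy
        refine ⟨d, hd, ?_⟩
        change tmul E F (π k.1 a) (ρ k.2 |y - d • b|) ≤ ε • tmul E F (π k.1 a) (ρ k.2 b)
        rw [← (hρ.isBandProjection k.2).map_abs, map_sub, (ρ k.2).map_smul]
        refine (hφ.mono_right (hπa k.1) hyd).trans_eq ?_
        rw [map_smul]
    have hle : |eval (φ k) s| ≤ |mk s| := by
      rw [hsum]
      exact Finset.single_le_sum (f := fun k => |eval (φ k) s|) (fun k _ => abs_nonneg _)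
        (Finset.mem_univ k)
    have hTe : T (eval (φ k) s) = 0 := by
      have := hTmono _ _ hle
      rw [hTabs, hTabs, hh, abs_zero] at this
      exact eq_zero_of_abs_le_zero this
    -- A small coefficient bounds the piece directly. For a large one, applying `T` to `hc` gives
    -- `(|c| - C * ε) • T (D k) ≤ 0`, so `T (D k) = 0`; then `D k = 0` by faithfulness and the piece
    -- vanishes.
    by_cases hcε : |c| ≤ C * ε
    · calc |eval (φ k) s| = |(eval (φ k) s - c • D k) + c • D k| := by rw [sub_add_cancel]
        _ ≤ (C * ε) • D k + |c| • D k := by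
          refine (abs_add_le _ _).trans (add_le_add hc ?_)
          rw [abs_smul_eq, abs_of_nonneg (hD0 k)]
        _ ≤ (C * ε) • D k + (C * ε) • D k := by
          gcongr
          exact hD0 k
        _ = _ := by rw [← add_smul]; congr 1; ring
    · have hTD : T (D k) = 0 := by
        have := hTmono _ _ hc
        rw [hTabs, map_sub, hTe, zero_sub, abs_neg, map_smul, map_smul, abs_smul_eq,
          abs_of_nonneg (hT0 _ (hD0 k)), ← sub_nonpos, ← sub_smul] at this
        have h1 : 0 < |c| - C * ε := sub_pos.2 (not_le.1 hcε)
        have h2 := smul_le_smul_of_nonneg_left this (inv_nonneg.2 h1.le)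
        rw [smul_zero, smul_smul, inv_mul_cancel₀ h1.ne', one_smul] at h2
        exact le_antisymm h2 (hT0 _ (hD0 k))
      have hDk : D k = 0 := by
        rcases hT' _ _ (hπa k.1) (hρb k.2) hTD with h1 | h1
        · simp only [D, h1, map_zero, LinearMap.zero_apply]
        · simp only [D, h1, map_zero]
      have := hbound k
      rw [hDk, smul_zero] at this ⊢
      exact this
  rw [hsum]
  refine (Finset.sum_le_sum fun k _ => hpiece k).trans_eq ?_
  rw [← Finset.smul_sum, sum_tmul hπ hρ, smul_smul, mul_comm]

end Injective

end FremlinTensor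

/-! ### Generic points of a Riesz space

A generic point of an Archimedean Riesz space `F` with weak order unit `f` is a decreasing sequence
of strictly positive elements that meets sufficiently many dense sets. Every element of `F` has a
real value, relative to `f`, at almost all generic points. -/

namespace RieszSpace

/-! ### Forcing inequalities below positive elements -/

section Forces

variable {F : Type*} [AddCommGroup F] [Lattice F] [IsOrderedAddMonoid F]

/-- The element `y` is nonpositive on the band generated by `v`. -/
def Forces (v y : F) : Prop := y⁺ ⊓ v = 0

theorem Forces.mono {v y z : F} (hv : 0 ≤ v) (h : Forces v z) (hyz : y ≤ z) : Forces v y :=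
  inf_eq_zero_of_le (posPart_nonneg y) hv (posPart_mono hyz) le_rfl h

theorem Forces.anti {v w y : F} (hw : 0 ≤ w) (hwv : w ≤ v) (h : Forces v y) : Forces w y :=
  inf_eq_zero_of_le (posPart_nonneg y) hw le_rfl hwv h

theorem forces_of_nonpos {v y : F} (hv : 0 ≤ v) (hy : y ≤ 0) : Forces v y := by
  rw [Forces, posPart_eq_zero.2 hy, inf_eq_left.2 hv]

theorem Forces.add {v y z : F} (hv : 0 ≤ v) (hy : Forces v y) (hz : Forces v z) :
    Forces v (y + z) :=
  inf_eq_zero_of_le (posPart_nonneg _) hv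
    (sup_le (add_le_add (le_posPart y) (le_posPart z))
      (add_nonneg (posPart_nonneg y) (posPart_nonneg z))) le_rfl
    (add_inf_eq_zero (posPart_nonneg y) (posPart_nonneg z) hv hy hz)

theorem Forces.sup {v y z : F} (hv : 0 ≤ v) (hy : Forces v y) (hz : Forces v z) :
    Forces v (y ⊔ z) :=
  inf_eq_zero_of_le (posPart_nonneg _) hv
    (sup_le (sup_le ((le_posPart y).trans (le_add_of_nonneg_right (posPart_nonneg z)))
      ((le_posPart z).trans (le_add_of_nonneg_left (posPart_nonneg y))))
      (add_nonneg (posPart_nonneg y) (posPart_nonneg z))) le_rfl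
    (add_inf_eq_zero (posPart_nonneg y) (posPart_nonneg z) hv hy hz)

theorem Forces.smul [Module ℝ F] [IsOrderedModule ℝ F] {v y : F} (hv : 0 ≤ v) (hy : Forces v y)
    {c : ℝ} (hc : 0 ≤ c) : Forces v (c • y) := by
  rw [Forces, posPart_def, ← smul_zero c, ← smul_sup_of_nonneg hc]
  exact (smul_inf_eq_zero (posPart_nonneg y) hv hy hc).trans (smul_zero c).symm

/-- This decides signs: if `w` does not force `y`, then `y⁺ ⊓ w` is a strictly positive element
below `w` that forces `-y`. -/
theorem forces_posPart_inf (y w : F) (hw : 0 ≤ w) : Forces (y⁺ ⊓ w) (-y) := by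
  refine inf_eq_zero_of_le (posPart_nonneg _) (le_inf (posPart_nonneg _) hw) le_rfl inf_le_left ?_
  rw [inf_comm, posPart_neg]
  exact posPart_inf_negPart_eq_zero y

end Forces

/-! ### Generic sequences and their filter -/

section Generic

variable (F : Type*) [AddCommGroup F] [Lattice F] [IsOrderedAddMonoid F]

/-- `D` is dense among the strictly positive elements. -/
def IsDenseBelow {F : Type*} [AddCommGroup F] [Lattice F] (D : Set F) : Prop :=
  ∀ v : F, 0 < v → ∃ w ∈ D, 0 < w ∧ w ≤ v

/-- Decreasing sequences of strictly positive elements meeting all sets in `𝒟`. -/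
def genericSequences {F : Type*} [AddCommGroup F] [Lattice F] (𝒟 : Set (Set F)) : Set (ℕ → F) :=
  {ω | Antitone ω ∧ (∀ n, 0 < ω n) ∧ ∀ D ∈ 𝒟, ∃ n, ω n ∈ D}

/-- The filter on sequences generated by genericity for countably many dense sets. -/
def genericFilter : Filter (ℕ → F) :=
  Filter.ofCountableInter
    {S | ∃ 𝒟 : Set (Set F), 𝒟.Countable ∧ (∀ D ∈ 𝒟, IsDenseBelow D) ∧ genericSequences 𝒟 ⊆ S}
    (fun 𝒮 h𝒮 h => by
      have h' : ∀ S ∈ 𝒮, ∃ 𝒟 : Set (Set F), 𝒟.Countable ∧ (∀ D ∈ 𝒟, IsDenseBelow D) ∧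
        genericSequences 𝒟 ⊆ S := h
      choose! 𝒟 h𝒟 using h'
      refine ⟨⋃ S ∈ 𝒮, 𝒟 S, h𝒮.biUnion fun S hS => (h𝒟 S hS).1, fun D hD => ?_, fun ω hω => ?_⟩
      · obtain ⟨S, hS, hDS⟩ := Set.mem_iUnion₂.1 hD
        exact (h𝒟 S hS).2.1 D hDS
      · exact Set.mem_sInter.2 fun S hS => (h𝒟 S hS).2.2
          ⟨hω.1, hω.2.1, fun D hD => hω.2.2 D (Set.mem_iUnion₂.2 ⟨S, hS, hD⟩)⟩)
    (fun _ _ ⟨𝒟, h1, h2, h3⟩ h => ⟨𝒟, h1, h2, h3.trans h⟩)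

instance : CountableInterFilter (genericFilter F) :=
  Filter.countableInter_ofCountableInter _ _ _

variable {F}

theorem mem_genericFilter {S : Set (ℕ → F)} : S ∈ genericFilter F ↔
    ∃ 𝒟 : Set (Set F), 𝒟.Countable ∧ (∀ D ∈ 𝒟, IsDenseBelow D) ∧ genericSequences 𝒟 ⊆ S :=
  Iff.rfl

theorem eventually_antitone_pos : ∀ᶠ ω in genericFilter F, Antitone ω ∧ ∀ n, 0 < ω n :=
  mem_genericFilter.2 ⟨∅, Set.countable_empty, by simp, fun _ hω => ⟨hω.1, hω.2.1⟩⟩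

theorem eventually_exists_mem {D : Set F} (hD : IsDenseBelow D) :
    ∀ᶠ ω in genericFilter F, ∃ n, ω n ∈ D :=
  mem_genericFilter.2 ⟨{D}, Set.countable_singleton D, by simpa using hD,
    fun _ hω => hω.2.2 D rfl⟩

/-- Below every strictly positive element there is a generic sequence. -/
theorem exists_generic_sequence {P : (ℕ → F) → Prop} (hP : ∀ᶠ ω in genericFilter F, P ω) {v : F}
    (hv : 0 < v) : ∃ ω, P ω ∧ ω 0 = v := by
  obtain ⟨𝒟, hc, hd, hsub⟩ := mem_genericFilter.1 hP
  -- The whole space is added so that the family is nonempty and can be enumerated by `ℕ`.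
  obtain ⟨D, hD⟩ := (hc.insert Set.univ).exists_eq_range (Set.insert_nonempty _ _)
  have hdense : ∀ n, IsDenseBelow (D n) := fun n => by
    have : D n ∈ insert Set.univ 𝒟 := hD ▸ Set.mem_range_self n
    rcases Set.mem_insert_iff.1 this with h | h
    · rw [h]; exact fun v hv => ⟨v, trivial, hv, le_rfl⟩
    · exact hd _ h
  have step : ∀ (n : ℕ) (w : {w : F // 0 < w}), ∃ w' : {w : F // 0 < w},
      w'.1 ≤ w.1 ∧ w'.1 ∈ D n := fun n w => by
    obtain ⟨w', h1, h2, h3⟩ := hdense n w.1 w.2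
    exact ⟨⟨w', h2⟩, h3, h1⟩
  choose g hg1 hg2 using step
  let ω : ℕ → {w : F // 0 < w} := fun n => Nat.rec ⟨v, hv⟩ (fun k w => g k w) n
  refine ⟨fun n => (ω n).1, hsub ⟨antitone_nat_of_succ_le fun n => hg1 n (ω n),
    fun n => (ω n).2, fun A hA => ?_⟩, rfl⟩
  have : A ∈ Set.range D := hD ▸ Set.mem_insert_of_mem _ hA
  obtain ⟨n, rfl⟩ := this
  exact ⟨n + 1, hg2 n (ω n)⟩

end Generic

/-! ### Values relative to a weak order unit -/

section Value

variable {F : Type*} [AddCommGroup F] [Lattice F] [IsOrderedAddMonoid F] [Module ℝ F]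
  [IsOrderedModule ℝ F] {f : F}

/-- Otherwise `f` and `v` would be disjoint, which the weak order unit excludes. All contradictions
about values reduce to this one. -/
theorem not_forces_smul (hf : IsWeakOrderUnit f) {v : F} (hv : 0 < v) {c : ℝ} (hc : 0 < c) :
    ¬ Forces v (c • f) := fun h => by
  have h1 := h.smul hv.le (inv_nonneg.2 hc.le)
  rw [smul_smul, inv_mul_cancel₀ hc.ne', one_smul, Forces, posPart_of_nonneg hf.1] at h1
  refine hv.ne' (hf.2 v ?_)
  rwa [abs_of_nonneg hv.le, inf_comm]

theorem nonpos_of_forces_smul (hf : IsWeakOrderUnit f) {v : F} (hv : 0 < v) {c : ℝ}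
    (h : Forces v (c • f)) : c ≤ 0 :=
  not_lt.1 fun hc => not_forces_smul hf hv hc h

/-- The element `y` has value `r` relative to `f` at the sequence `ω`. -/
def IsValue (f : F) (ω : ℕ → F) (y : F) (r : ℝ) : Prop :=
  ∀ ε : ℝ, 0 < ε → ∃ n, Forces (ω n) (|y - r • f| - ε • f)

theorem abs_sub_le_of_forces (hf : IsWeakOrderUnit f) {v : F} (hv : 0 < v) {y : F} {r s δ ε : ℝ}
    (h : Forces v (|y - r • f| - δ • f)) (h' : Forces v (|y - s • f| - ε • f)) :
    |r - s| ≤ δ + ε := by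
  have h1 : (|r - s| - (δ + ε)) • f ≤ (|y - r • f| - δ • f) + (|y - s • f| - ε • f) := by
    have h2 : |r - s| • f ≤ |y - r • f| + |y - s • f| := by
      rw [← abs_of_nonneg hf.1, ← abs_smul_eq, abs_of_nonneg hf.1, abs_sub_comm (y) (r • f)]
      refine le_of_eq_of_le ?_ (abs_add_le (r • f - y) (y - s • f))
      rw [sub_smul, sub_add_sub_cancel]
    rw [sub_smul, add_smul, ← add_sub_add_comm]
    exact sub_le_sub_right h2 _
  have := nonpos_of_forces_smul hf hv ((h.add hv.le h').mono hv.le h1)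
  linarith

theorem IsValue.unique (hf : IsWeakOrderUnit f) {ω : ℕ → F} (hω : Antitone ω)
    (hω0 : ∀ n, 0 < ω n) {y : F} {r s : ℝ} (hr : IsValue f ω y r) (hs : IsValue f ω y s) :
    r = s := by
  refine sub_eq_zero.1 (abs_nonpos_iff.1 (le_of_forall_pos_le_add fun ε hε => ?_))
  obtain ⟨m, hm⟩ := hr (ε / 2) (by positivity)
  obtain ⟨n, hn⟩ := hs (ε / 2) (by positivity)
  have := abs_sub_le_of_forces hf (hω0 (max m n))
    (hm.anti (hω0 _).le (hω (le_max_left m n))) (hn.anti (hω0 _).le (hω (le_max_right m n)))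
  linarith

/-- Sum and supremum are both 1-Lipschitz in the summed distance, so this one estimate computes
their values. -/
theorem IsValue.of_abs_le {ω : ℕ → F} (hω : Antitone ω)
    (hω0 : ∀ n, 0 < ω n) {w y z : F} {r s t : ℝ} (hr : IsValue f ω y r) (hs : IsValue f ω z s)
    (h : |w - t • f| ≤ |y - r • f| + |z - s • f|) : IsValue f ω w t := fun ε hε => by
  obtain ⟨m, hm⟩ := hr (ε / 2) (by positivity)
  obtain ⟨n, hn⟩ := hs (ε / 2) (by positivity)
  refine ⟨max m n, ((hm.anti (hω0 _).le (hω (le_max_left m n))).add (hω0 _).le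
    (hn.anti (hω0 _).le (hω (le_max_right m n)))).mono (hω0 _).le ?_⟩
  rw [← add_sub_add_comm, ← add_smul, add_halves]
  exact sub_le_sub_right h _

theorem IsValue.add {ω : ℕ → F} (hω : Antitone ω)
    (hω0 : ∀ n, 0 < ω n) {y z : F} {r s : ℝ} (hr : IsValue f ω y r) (hs : IsValue f ω z s) :
    IsValue f ω (y + z) (r + s) := by
  refine hr.of_abs_le hω hω0 hs ?_
  rw [add_smul, add_sub_add_comm]
  exact abs_add_le _ _

theorem IsValue.sup (hf : IsWeakOrderUnit f) {ω : ℕ → F} (hω : Antitone ω)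
    (hω0 : ∀ n, 0 < ω n) {y z : F} {r s : ℝ} (hr : IsValue f ω y r) (hs : IsValue f ω z s) :
    IsValue f ω (y ⊔ z) (r ⊔ s) := by
  refine hr.of_abs_le hω hω0 hs ?_
  rw [sup_smul_of_nonneg hf.1]
  exact abs_sup_sub_sup_le_add _ _ _ _

theorem IsValue.smul (hf : IsWeakOrderUnit f) {ω : ℕ → F} (hω0 : ∀ n, 0 < ω n) {y : F} {r : ℝ}
    (hr : IsValue f ω y r) (c : ℝ) : IsValue f ω (c • y) (c * r) := fun ε hε => by
  have hc : 0 < |c| + 1 := by positivity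
  -- The summand 1 covers `c = 0`.
  obtain ⟨n, hn⟩ := hr (ε / (|c| + 1)) (by positivity)
  refine ⟨n, (hn.smul (hω0 n).le (abs_nonneg c)).mono (hω0 n).le ?_⟩
  rw [mul_smul, ← smul_sub, abs_smul_eq, smul_sub, smul_smul]
  refine sub_le_sub_left (smul_le_smul_of_nonneg_right ?_ hf.1) _
  rw [← mul_div_assoc, div_le_iff₀ hc]
  nlinarith

theorem isValue_self (hf : IsWeakOrderUnit f) {ω : ℕ → F} (hω0 : ∀ n, 0 < ω n) :
    IsValue f ω f 1 := fun ε hε => ⟨0, forces_of_nonpos (hω0 0).le (by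
  rw [one_smul, sub_self, abs_zero, zero_sub]
  exact neg_nonpos.2 (smul_nonneg hε.le hf.1))⟩

/-- Below every strictly positive element, `y` is bounded by a multiple of `f`. -/
theorem exists_forces_bound [IsArchimedeanRiesz F] (hf : IsWeakOrderUnit f) (y : F) {v : F}
    (hv : 0 < v) : ∃ (N : ℕ) (w : F), 0 < w ∧ w ≤ v ∧ Forces w (|y| - N • f) := by
  by_contra! hcon
  -- A nonzero infimum would itself be the required `w`. So `|y|` dominates every `N • f` on the
  -- band of `v`, which yields `N • (f ⊓ v) ≤ |y|` and, by the Archimedean property, `f ⊓ v = 0`.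
  have h0 : ∀ N : ℕ, (N • f - |y|)⁺ ⊓ v = 0 := fun N => by
    by_contra hne
    refine hcon N _ (lt_of_le_of_ne (le_inf (posPart_nonneg _) hv.le) (Ne.symm hne))
      inf_le_right ?_
    have := forces_posPart_inf (N • f - |y|) v hv.le
    rwa [neg_sub] at this
  have hg0 : 0 ≤ f ⊓ v := le_inf hf.1 hv.le
  have hg : ∀ N : ℕ, N • (f ⊓ v) ≤ |y| := fun N => by
    have h1 : (N • (f ⊓ v) - |y|)⁺ ⊓ (f ⊓ v) = 0 :=
      inf_eq_zero_of_le (posPart_nonneg _) hg0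
        (posPart_mono (sub_le_sub_right (nsmul_le_nsmul_right inf_le_left N) _)) inf_le_right
        (h0 N)
    have h2 := nsmul_inf_eq_zero hg0 (posPart_nonneg _) (by rwa [inf_comm] at h1) N
    have h3 : (N • (f ⊓ v) - |y|)⁺ ≤ N • (f ⊓ v) :=
      sup_le (sub_le_self _ (abs_nonneg y)) (nsmul_nonneg hg0 N)
    rw [inf_eq_right.2 h3] at h2
    exact sub_nonpos.1 (posPart_eq_zero.1 h2)
  have h4 := le_antisymm (IsArchimedeanRiesz.le_zero _ _ hg) hg0
  refine hv.ne' (hf.2 v ?_)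
  rwa [abs_of_nonneg hv.le, inf_comm]

/-- Bisection: starting from a bound by `N • f`, each step shrinks `w` until the sign of `y - r • f`
is decided, then moves `r` by half the old radius. -/
theorem exists_forces_abs_sub_le [IsArchimedeanRiesz F] (hf : IsWeakOrderUnit f) (y : F) {v : F}
    (hv : 0 < v) {ε : ℝ} (hε : 0 < ε) :
    ∃ (w : F) (r : ℝ), 0 < w ∧ w ≤ v ∧ Forces w (|y - r • f| - ε • f) := by
  obtain ⟨N, w, hw0, hwv, hw⟩ := exists_forces_bound hf y hv
  have key : ∀ j : ℕ, ∃ (w : F) (r : ℝ), 0 < w ∧ w ≤ v ∧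
      Forces w (|y - r • f| - ((N : ℝ) / 2 ^ j) • f) := fun j => by
    induction j with
    | zero => exact ⟨w, 0, hw0, hwv, by simpa [Nat.cast_smul_eq_nsmul] using hw⟩
    | succ j ih =>
      obtain ⟨w, r, hw0, hwv, hw⟩ := ih
      set δ : ℝ := (N : ℝ) / 2 ^ (j + 1) with hδ
      have hδ2 : (N : ℝ) / 2 ^ j = δ + δ := by rw [hδ, pow_succ]; field_simp; norm_num
      rw [hδ2] at hw
      have habs : ∀ z : F, |z| - δ • f = (z - δ • f) ⊔ (-z - δ • f) := fun z => by
        rw [abs, sup_sub]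
      by_cases hcase : (y - r • f)⁺ ⊓ w = 0
      · refine ⟨w, r - δ, hw0, hwv, ?_⟩
        rw [habs]
        refine Forces.sup hw0.le (Forces.mono hw0.le hcase (le_of_eq ?_)) (hw.mono hw0.le ?_)
        · rw [sub_smul]; abel
        · refine le_of_eq_of_le ?_ (sub_le_sub_right (neg_le_abs _) _)
          rw [sub_smul, add_smul]; abel
      · have hpos : 0 < (y - r • f)⁺ ⊓ w :=
          lt_of_le_of_ne (le_inf (posPart_nonneg _) hw0.le) (Ne.symm hcase)
        refine ⟨_, r + δ, hpos, inf_le_right.trans hwv, ?_⟩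
        rw [habs]
        refine Forces.sup hpos.le ((hw.anti hpos.le inf_le_right).mono hpos.le ?_)
          ((forces_posPart_inf (y - r • f) w hw0.le).mono hpos.le (le_of_eq ?_))
        · refine le_of_eq_of_le ?_ (sub_le_sub_right (le_abs_self _) _)
          rw [add_smul, add_smul]; abel
        · rw [add_smul]; abel
  obtain ⟨j, hj⟩ := pow_unbounded_of_one_lt ((N : ℝ) / ε) (one_lt_two)
  obtain ⟨w, r, h1, h2, h3⟩ := key j
  refine ⟨w, r, h1, h2, h3.mono h1.le (sub_le_sub_left (smul_le_smul_of_nonneg_right ?_ hf.1) _)⟩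
  rw [div_lt_iff₀ hε] at hj
  rw [div_le_iff₀ (by positivity), mul_comm]
  exact hj.le

/-- For each `m`, the elements forcing an approximation of accuracy `1 / (m + 1)` are dense. A
sequence meeting these countably many sets supplies reals that are Cauchy by `abs_sub_le_of_forces`;
their limit is the value. -/
theorem eventually_exists_isValue [IsArchimedeanRiesz F] (hf : IsWeakOrderUnit f) (y : F) :
    ∀ᶠ ω in genericFilter F, ∃ r, IsValue f ω y r := by
  have hD : ∀ m : ℕ, ∀ᶠ ω in genericFilter F, ∃ n, ω n ∈
      {w : F | ∃ r : ℝ, Forces w (|y - r • f| - ((m : ℝ) + 1)⁻¹ • f)} := fun m =>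
    eventually_exists_mem fun v hv => by
      obtain ⟨w, r, h1, h2, h3⟩ := exists_forces_abs_sub_le hf y hv
        (by positivity : (0 : ℝ) < ((m : ℝ) + 1)⁻¹)
      exact ⟨w, ⟨r, h3⟩, h1, h2⟩
  filter_upwards [eventually_countable_forall.2 hD, eventually_antitone_pos] with ω h hω
  choose n r h using h
  have hdist : ∀ i j, |r i - r j| ≤ ((i : ℝ) + 1)⁻¹ + ((j : ℝ) + 1)⁻¹ := fun i j =>
    abs_sub_le_of_forces hf (hω.2 (max (n i) (n j)))
      ((h i).anti (hω.2 _).le (hω.1 (le_max_left _ _)))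
      ((h j).anti (hω.2 _).le (hω.1 (le_max_right _ _)))
  have hlim : Filter.Tendsto (fun i : ℕ => ((i : ℝ) + 1)⁻¹) Filter.atTop (nhds 0) := by
    simpa [one_div] using tendsto_one_div_add_atTop_nhds_zero_nat (𝕜 := ℝ)
  have hanti : ∀ i j : ℕ, i ≤ j → ((j : ℝ) + 1)⁻¹ ≤ ((i : ℝ) + 1)⁻¹ := fun i j hij => by
    gcongr
  have hcauchy : CauchySeq r := by
    refine cauchySeq_of_le_tendsto_0 (fun i : ℕ => ((i : ℝ) + 1)⁻¹ + ((i : ℝ) + 1)⁻¹)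
      (fun i j k hi hj => ?_) (by simpa using hlim.add hlim)
    rw [Real.dist_eq]
    exact (hdist i j).trans (add_le_add (hanti _ _ hi) (hanti _ _ hj))
  obtain ⟨s, hs⟩ := cauchySeq_tendsto_of_complete hcauchy
  have hrs : ∀ i, |r i - s| ≤ ((i : ℝ) + 1)⁻¹ := fun i => by
    refine le_of_tendsto_of_tendsto (hs.const_sub (r i)).abs
      (by simpa using hlim.const_add (((i : ℝ) + 1)⁻¹)) (Filter.Eventually.of_forall (hdist i))
  refine ⟨s, fun ε hε => ?_⟩
  obtain ⟨i, hi⟩ := exists_nat_one_div_lt (half_pos hε)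
  rw [one_div] at hi
  refine ⟨n i, (h i).mono (hω.2 _).le ?_⟩
  have h1 : |y - s • f| ≤ |y - r i • f| + (((i : ℝ) + 1)⁻¹) • f := by
    calc |y - s • f| = |(y - r i • f) + (r i - s) • f| := by rw [sub_smul, sub_add_sub_cancel]
      _ ≤ |y - r i • f| + |r i - s| • f := by
        refine (abs_add_le _ _).trans_eq ?_
        rw [abs_smul_eq, abs_of_nonneg hf.1]
      _ ≤ _ := add_le_add_right (smul_le_smul_of_nonneg_right (hrs i) hf.1) _
  rw [sub_le_iff_le_add, sub_add_eq_add_sub, add_sub_assoc, ← sub_smul]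
  refine h1.trans (add_le_add_right (smul_le_smul_of_nonneg_right ?_ hf.1) _)
  linarith

open Classical in
/-- The value of `y` relative to `f` at the sequence `ω`, and `0` if there is none. -/
noncomputable def value (f : F) (ω : ℕ → F) (y : F) : ℝ :=
  if h : ∃ r, IsValue f ω y r then h.choose else 0

theorem eventually_isValue_value [IsArchimedeanRiesz F] (hf : IsWeakOrderUnit f) (y : F) :
    ∀ᶠ ω in genericFilter F, IsValue f ω y (value f ω y) := by
  filter_upwards [eventually_exists_isValue hf y] with ω h
  rw [value, dif_pos h]
  exact h.choose_spec

/-- The exceptional set depends on `y` and `z`, so no single sequence need make the value additive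
everywhere; hence the passage to germs. -/
theorem eventually_value_add [IsArchimedeanRiesz F] (hf : IsWeakOrderUnit f) (y z : F) :
    ∀ᶠ ω in genericFilter F, value f ω (y + z) = value f ω y + value f ω z := by
  filter_upwards [eventually_antitone_pos, eventually_isValue_value hf y,
    eventually_isValue_value hf z, eventually_isValue_value hf (y + z)] with ω hω h1 h2 h3
  exact h3.unique hf hω.1 hω.2 (h1.add hω.1 hω.2 h2)

theorem eventually_value_sup [IsArchimedeanRiesz F] (hf : IsWeakOrderUnit f) (y z : F) :
    ∀ᶠ ω in genericFilter F, value f ω (y ⊔ z) = value f ω y ⊔ value f ω z := by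
  filter_upwards [eventually_antitone_pos, eventually_isValue_value hf y,
    eventually_isValue_value hf z, eventually_isValue_value hf (y ⊔ z)] with ω hω h1 h2 h3
  exact h3.unique hf hω.1 hω.2 (h1.sup hf hω.1 hω.2 h2)

theorem eventually_value_smul [IsArchimedeanRiesz F] (hf : IsWeakOrderUnit f) (c : ℝ) (y : F) :
    ∀ᶠ ω in genericFilter F, value f ω (c • y) = c * value f ω y := by
  filter_upwards [eventually_antitone_pos, eventually_isValue_value hf y,
    eventually_isValue_value hf (c • y)] with ω hω h1 h2
  exact h2.unique hf hω.1 hω.2 (h1.smul hf hω.2 c)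

theorem eventually_value_self [IsArchimedeanRiesz F] (hf : IsWeakOrderUnit f) :
    ∀ᶠ ω in genericFilter F, value f ω f = 1 := by
  filter_upwards [eventually_antitone_pos, eventually_isValue_value hf f] with ω hω h
  exact h.unique hf hω.1 hω.2 (isValue_self hf hω.2)

theorem eventually_value_nonneg [IsArchimedeanRiesz F] (hf : IsWeakOrderUnit f) {y : F}
    (hy : 0 ≤ y) : ∀ᶠ ω in genericFilter F, 0 ≤ value f ω y := by
  filter_upwards [eventually_value_sup hf y 0, eventually_value_smul hf 0 0] with ω h h'
  rw [zero_smul, zero_mul] at h'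
  rw [sup_eq_left.2 hy, h'] at h
  rw [h]
  exact le_sup_right

/-- If `y ≤ δ • f` fails, a generic sequence starting at `(y - δ • f)⁺` forces `y` above `δ • f`,
while value 0 forces `y` below `(δ / 2) • f`; together they force `(δ / 2) • f`, which is
impossible. -/
theorem eq_zero_of_eventually_value_eq_zero [IsArchimedeanRiesz F] (hf : IsWeakOrderUnit f)
    {y : F} (hy : 0 ≤ y) (h : ∀ᶠ ω in genericFilter F, value f ω y = 0) : y = 0 := by
  refine le_antisymm (le_zero_of_forall_le_smul hf.1 fun m => ?_) hy
  set δ : ℝ := ((m : ℝ) + 1)⁻¹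
  have hδ : 0 < δ := by positivity
  rw [← sub_nonpos, ← posPart_eq_zero]
  by_contra hne
  have hv : 0 < (y - δ • f)⁺ := lt_of_le_of_ne (posPart_nonneg _) (Ne.symm hne)
  obtain ⟨ω, ⟨h0, hval, hω⟩, hω_zero⟩ := exists_generic_sequence
    (h.and ((eventually_isValue_value hf y).and eventually_antitone_pos)) hv
  rw [h0] at hval
  obtain ⟨n, hn⟩ := hval (δ / 2) (by positivity)
  rw [zero_smul, sub_zero, abs_of_nonneg hy] at hn
  have h1 := forces_posPart_inf (y - δ • f) _ hv.le
  rw [inf_idem, ← hω_zero] at h1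
  have h2 := (h1.anti (hω.2 n).le (hω.1 (Nat.zero_le n))).add (hω.2 n).le hn
  refine not_forces_smul hf (hω.2 n) (half_pos hδ) (h2.mono (hω.2 n).le (le_of_eq ?_))
  nth_rewrite 2 [← add_halves δ]
  rw [add_smul]
  abel

end Value

end RieszSpace

/-! ### Bimorphisms into spaces of germs -/

namespace RieszSpace

open Filter

section Germ

variable {X E : Type*} (l : Filter X) [AddCommGroup E] [Lattice E] [IsOrderedAddMonoid E]
  [Module ℝ E] [IsOrderedModule ℝ E]

instance germ_isOrderedModule : IsOrderedModule ℝ (Germ l E) where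
  smul_le_smul_of_nonneg_left c hc a b hab := by
    induction a using Germ.inductionOn with | h g =>
    induction b using Germ.inductionOn with | h g' =>
    filter_upwards [Germ.coe_le.1 hab] with x hx
    exact smul_le_smul_of_nonneg_left hx hc
  smul_le_smul_of_nonneg_right a ha c d hcd := by
    induction a using Germ.inductionOn with | h g =>
    filter_upwards [Germ.coe_le.1 ha] with x hx
    exact smul_le_smul_of_nonneg_right hcd hx

/-- The inequalities for all `n` hold simultaneously on one set of the filter, thanks to closure
under countable intersections. -/
instance germ_isArchimedeanRiesz [CountableInterFilter l] [IsArchimedeanRiesz E] :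
    IsArchimedeanRiesz (Germ l E) where
  le_zero a b h := by
    induction a using Germ.inductionOn with | h g =>
    induction b using Germ.inductionOn with | h g' =>
    have h1 : ∀ n : ℕ, ∀ᶠ x in l, n • g x ≤ g' x := fun n => Germ.coe_le.1 (h n)
    filter_upwards [eventually_countable_forall.2 h1] with x hx
    exact IsArchimedeanRiesz.le_zero _ _ hx

end Germ

section Bimorphism

variable {E F : Type*}
  [AddCommGroup E] [Lattice E] [IsOrderedAddMonoid E] [Module ℝ E] [IsOrderedModule ℝ E]
  [AddCommGroup F] [Lattice F] [IsOrderedAddMonoid F] [Module ℝ F] [IsOrderedModule ℝ F]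
  [IsArchimedeanRiesz F] {f : F}

/-- The bilinear map sending `(x, y)` to the germ of `ω ↦ y(ω) x`, where `y(ω)` is the value of `y`
relative to the weak order unit `f` at the generic sequence `ω`. -/
noncomputable def germBimorphism (E : Type*) [AddCommGroup E] [Module ℝ E]
    (hf : IsWeakOrderUnit f) : E →ₗ[ℝ] F →ₗ[ℝ] Germ (genericFilter F) E :=
  LinearMap.mk₂ ℝ (fun x y => ((fun ω => value f ω y • x : (ℕ → F) → E) : Germ _ E))
    (fun x x' y => Germ.coe_eq.2 (.of_forall fun ω => smul_add _ _ _))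
    (fun c x y => Germ.coe_eq.2 (.of_forall fun ω => smul_comm _ _ _))
    (fun x y y' => Germ.coe_eq.2 <| by
      filter_upwards [eventually_value_add hf y y'] with ω h
      rw [h, add_smul])
    (fun c x y => Germ.coe_eq.2 <| by
      filter_upwards [eventually_value_smul hf c y] with ω h
      rw [h, mul_smul]; rfl)

theorem germBimorphism_apply (hf : IsWeakOrderUnit f) (x : E) (y : F) :
    germBimorphism E hf x y =
      ((fun ω => value f ω y • x : (ℕ → F) → E) : Germ (genericFilter F) E) := rfl

theorem germBimorphism_self (hf : IsWeakOrderUnit f) (x : E) :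
    germBimorphism E hf x f = ((fun _ => x : (ℕ → F) → E) : Germ (genericFilter F) E) := by
  rw [germBimorphism_apply]
  refine Germ.coe_eq.2 ?_
  filter_upwards [eventually_value_self hf] with ω h
  rw [h, one_smul]

theorem isRieszBimorphism_germBimorphism (hf : IsWeakOrderUnit f) :
    IsRieszBimorphism (germBimorphism E hf) where
  sup_right x y y' hx := Germ.coe_eq.2 <| by
    filter_upwards [eventually_value_sup hf y y'] with ω h
    rw [h, sup_smul_of_nonneg hx]
  sup_left x x' y hy := Germ.coe_eq.2 <| by
    filter_upwards [eventually_value_nonneg hf hy] with ω h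
    rw [smul_sup_of_nonneg h]

theorem eq_zero_or_eq_zero_of_germBimorphism_eq_zero (hf : IsWeakOrderUnit f) {x : E} {y : F}
    (hy : 0 ≤ y) (h : germBimorphism E hf x y = 0) : x = 0 ∨ y = 0 := by
  by_cases hx : x = 0
  · exact Or.inl hx
  · refine Or.inr (eq_zero_of_eventually_value_eq_zero hf hy ?_)
    filter_upwards [Germ.coe_eq.1 h] with ω hω
    exact (smul_eq_zero.1 hω).resolve_right hx

end Bimorphism

end RieszSpace

theorem IsRieszBimorphism.flip {E F G : Type*}
    [AddCommGroup E] [Lattice E] [Module ℝ E] [AddCommGroup F] [Lattice F] [Module ℝ F]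
    [AddCommGroup G] [Lattice G] [Module ℝ G] {φ : E →ₗ[ℝ] F →ₗ[ℝ] G}
    (h : IsRieszBimorphism φ) : IsRieszBimorphism φ.flip where
  sup_right x y y' hx := h.sup_left y y' x hx
  sup_left x x' y hy := h.sup_right y x x' hy

/-! ### Order continuity of the tensor product in each variable -/

namespace FremlinTensor

open RieszSpace Filter

section

variable {E F : Type*}
  [AddCommGroup E] [ConditionallyCompleteLattice E] [IsOrderedAddMonoid E] [Module ℝ E]
  [IsOrderedModule ℝ E]
  [AddCommGroup F] [ConditionallyCompleteLattice F] [IsOrderedAddMonoid F] [Module ℝ F]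
  [IsOrderedModule ℝ F]

/-- If the image of a sequence of elementary tensors under a faithful Riesz bimorphism has only
nonpositive lower bounds, then so has the sequence itself. -/
theorem nonpos_of_forall_le {H : Type*} [AddCommGroup H] [Lattice H] [IsOrderedAddMonoid H]
    [Module ℝ H] [IsOrderedModule ℝ H] [IsArchimedeanRiesz H] {φ : E →ₗ[ℝ] F →ₗ[ℝ] H}
    (hφ : IsRieszBimorphism φ) (hφ0 : ∀ x y, 0 ≤ x → 0 ≤ y → φ x y = 0 → x = 0 ∨ y = 0)
    {x : ℕ → E} {y : ℕ → F} (hxy : ∀ g : H, (∀ n, g ≤ φ (x n) (y n)) → g ≤ 0)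
    {h : FremlinTensorProduct E F} (hh : ∀ n, h ≤ tmul E F (x n) (y n)) : h ≤ 0 := by
  obtain ⟨T, ⟨hT, hT'⟩, -⟩ := existsUnique_lift φ hφ
  have hmono : ∀ g g', g ≤ g' → T g ≤ T g' := fun g g' hg => by
    have h1 := hT g g'
    rw [sup_eq_right.2 hg] at h1
    rw [h1]; exact le_sup_left
  have h1 : T h ≤ 0 := hxy _ fun n => hT' (x n) (y n) ▸ hmono _ _ (hh n)
  -- Injectivity reflects order: `T` sends `h ⊔ 0` to `T h ⊔ 0 = 0`.
  have h2 : h ⊔ 0 = 0 := by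
    refine eq_zero_of_map_eq_zero T hT (fun x y hx hy h0 => hφ0 x y hx hy (hT' x y ▸ h0)) _ ?_
    rw [hT, map_zero, sup_eq_right.2 h1]
  exact sup_eq_right.1 h2

theorem germ_nonpos_of_forall_le_const {X : Type*} {l : Filter X} [CountableInterFilter l] {u : ℕ → E}
    (hu : IsGLB (Set.range u) 0) (g : Germ l E)
    (hg : ∀ n, g ≤ ((fun _ => u n : X → E) : Germ l E)) : g ≤ 0 := by
  induction g using Germ.inductionOn with | h g =>
  filter_upwards [eventually_countable_forall.2 fun n => Germ.coe_le.1 (hg n)] with x hx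
  exact hu.2 (by rintro _ ⟨n, rfl⟩; exact hx n)

/-- Generic points are taken in the factor carrying the unit `f`: there `f` has value 1, so `u n ⊗
f` becomes the constant germ `u n`. -/
theorem nonpos_of_le_tmul_left {f : F} (hf : IsWeakOrderUnit f) {u : ℕ → E}
    (hu : IsGLB (Set.range u) 0) {h : FremlinTensorProduct E F}
    (hh : ∀ n, h ≤ tmul E F (u n) f) : h ≤ 0 := by
  refine nonpos_of_forall_le (isRieszBimorphism_germBimorphism hf)
    (fun x y _ hy h0 => eq_zero_or_eq_zero_of_germBimorphism_eq_zero hf hy h0)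
    (fun g hg => germ_nonpos_of_forall_le_const hu g fun n => ?_) hh
  rw [← germBimorphism_self hf]
  exact hg n

theorem nonpos_of_le_tmul_right {e : E} (he : IsWeakOrderUnit e) {u : ℕ → F}
    (hu : IsGLB (Set.range u) 0) {h : FremlinTensorProduct E F}
    (hh : ∀ n, h ≤ tmul E F e (u n)) : h ≤ 0 := by
  refine nonpos_of_forall_le (isRieszBimorphism_germBimorphism he).flip
    (fun x y hx _ h0 => (eq_zero_or_eq_zero_of_germBimorphism_eq_zero he hx h0).symm)
    (fun g hg => germ_nonpos_of_forall_le_const hu g fun n => ?_) hh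
  rw [← germBimorphism_self he]
  exact hg n

end

/-! ### Components of elementary tensors -/

section

variable {E F : Type*}
  [AddCommGroup E] [Lattice E] [IsOrderedAddMonoid E] [Module ℝ E]
  [AddCommGroup F] [Lattice F] [IsOrderedAddMonoid F] [Module ℝ F]

/-- The complement splits as `(e - p) ⊗ f + p ⊗ (f - q)`. The first term is disjoint even from `p ⊗
f`, the second from `p ⊗ q` because `f - q` is disjoint from `q`. -/
theorem isComponent_tmul {e p : E} {f q : F} (hp : IsComponent e p) (hq : IsComponent f q) :
    IsComponent (tmul E F e f) (tmul E F p q) := by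
  have hφ := tmul_isRieszBimorphism (E := E) (F := F)
  obtain ⟨hp0, hpe, hp⟩ := hp
  obtain ⟨hq0, hqf, hq⟩ := hq
  have hep := sub_nonneg.2 hpe
  have hfq := sub_nonneg.2 hqf
  have hf0 := hq0.trans hqf
  have h0 := hφ.nonneg hp0 hq0
  refine ⟨h0, (hφ.mono_left hpe hq0).trans (hφ.mono_right (hp0.trans hpe) hqf), ?_⟩
  have h1 : tmul E F e f - tmul E F p q = tmul E F (e - p) f + tmul E F p (f - q) := by
    simp only [map_sub, LinearMap.sub_apply]; abel
  rw [h1]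
  refine add_inf_eq_zero (hφ.nonneg hep hf0) (hφ.nonneg hp0 hfq) h0 ?_ ?_
  · refine inf_eq_zero_of_le (hφ.nonneg hep hf0) h0 le_rfl (hφ.mono_right hp0 hqf) ?_
    rw [← hφ.inf_left _ _ hf0, hp, map_zero, LinearMap.zero_apply]
  · rw [← hφ.inf_right hp0, hq, map_zero]

end

end FremlinTensor

/-! ### Density zero in the Dedekind completion -/

namespace DedekindCompletion

variable {G : Type*} [AddCommGroup G] [Lattice G] [IsOrderedAddMonoid G] [Module ℝ G]
  [IsOrderedModule ℝ G] [IsArchimedeanRiesz G]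

theorem isComponent_of {e p : G} (h : IsComponent e p) : IsComponent (of e) (of p) := by
  refine ⟨of_le_of.2 h.1, of_le_of.2 h.2.1, ?_⟩
  have h1 : of e - of p = of (e - p) := (map_sub (ofLinear G) e p).symm
  rw [h1, ← of_inf, h.2.2]
  rfl

/-- A sequence of components of `e` in `G` is of density zero in the Dedekind completion if its
Cesàro means are dominated by a sequence decreasing to zero in `G`. -/
theorem isDensityZeroSeq_of {e : G} {p u : ℕ → G} (hp : ∀ n, IsComponent e (p n))
    (hu : Antitone u) (hu0 : ∀ h, (∀ n, h ≤ u n) → h ≤ 0)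
    (hpu : ∀ n : ℕ, (1 / (n : ℝ)) • ∑ k ∈ Finset.range n, p k ≤ u n) :
    IsDensityZeroSeq (of e) fun n => of (p n) := by
  have hnonneg : ∀ n : ℕ, 0 ≤ (1 / (n : ℝ)) • ∑ k ∈ Finset.range n, p k := fun n =>
    smul_nonneg (by positivity) (Finset.sum_nonneg fun k _ => (hp k).1)
  refine ⟨fun n => isComponent_of (hp n), fun n => of (u n), fun m n h => of_le_of.2 (hu h),
    ⟨?_, fun A hA => ?_⟩, fun n => ?_⟩
  · rintro _ ⟨n, rfl⟩
    exact of_le_of.2 ((hnonneg n).trans (hpu n))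
  -- A lower bound in the completion is determined by the elements of `G` below it, so lower bounds
  -- in `G` suffice.
  · refine le_iff_lower.2 fun h hh => of_le_of.2 (hu0 h fun n => of_le_of.1 ?_)
    exact hh.trans (hA ⟨n, rfl⟩)
  · have h1 : (1 / (n : ℝ)) • ∑ k ∈ Finset.range n, of (p k) =
        of ((1 / (n : ℝ)) • ∑ k ∈ Finset.range n, p k) := by
      change _ = ofLinear G _
      rw [map_smul, map_sum]
      rfl
    have h2 : (0 : DedekindCompletion G) ≤ of ((1 / (n : ℝ)) • ∑ k ∈ Finset.range n, p k) :=
      of_le_of.2 (hnonneg n)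
    beta_reduce
    rw [sub_zero, h1, abs_of_nonneg h2]
    exact of_le_of.2 (hpu n)

end DedekindCompletion

/-! ### Density zero sequences in the tensor product -/

theorem proposition3p3 {E F : Type*}
    [AddCommGroup E] [ConditionallyCompleteLattice E] [IsOrderedAddMonoid E]
    [Module ℝ E] [IsOrderedModule ℝ E]
    [AddCommGroup F] [ConditionallyCompleteLattice F] [IsOrderedAddMonoid F]
    [Module ℝ F] [IsOrderedModule ℝ F]
    (e : E) (f : F) (he : IsWeakOrderUnit e) (hf : IsWeakOrderUnit f)
    (p : ℕ → E) (q : ℕ → F)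
    (hp : ∀ n, IsComponent e (p n)) (hq : ∀ n, IsComponent f (q n))
    (hpq : IsDensityZeroSeq e p ∨ IsDensityZeroSeq f q) :
    IsDensityZeroSeq (dtmul e f : DedekindTensorProduct E F) (fun n => dtmul (p n) (q n)) := by
  have hφ := FremlinTensor.tmul_isRieszBimorphism (E := E) (F := F)
  have hcomp := fun n => FremlinTensor.isComponent_tmul (hp n) (hq n)
  rcases hpq with ⟨-, u, hu, hu0, hpu⟩ | ⟨-, u, hu, hu0, hqu⟩
  · refine DedekindCompletion.isDensityZeroSeq_of (u := fun n => FremlinTensor.tmul E F (u n) f)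
      hcomp (fun m n h => hφ.mono_left (hu h) hf.1)
      (fun h => FremlinTensor.nonpos_of_le_tmul_left hf hu0) fun n => ?_
    have h1 := (le_abs_self _).trans (hpu n)
    rw [sub_zero] at h1
    -- Replacing each `q k` by `f` turns the mean of the tensors into the mean of the `p k` tensored
    -- with `f`.
    refine le_trans ?_ (hφ.mono_left h1 hf.1)
    rw [map_smul, LinearMap.smul_apply, map_sum, LinearMap.sum_apply]
    exact smul_le_smul_of_nonneg_left
      (Finset.sum_le_sum fun k _ => hφ.mono_right (hp k).1 (hq k).2.1) (by positivity)
  · refine DedekindCompletion.isDensityZeroSeq_of (u := fun n => FremlinTensor.tmul E F e (u n))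
      hcomp (fun m n h => hφ.mono_right he.1 (hu h))
      (fun h => FremlinTensor.nonpos_of_le_tmul_right he hu0) fun n => ?_
    have h1 := (le_abs_self _).trans (hqu n)
    rw [sub_zero] at h1
    refine le_trans ?_ (hφ.mono_right he.1 h1)
    rw [map_smul, map_sum]
    exact smul_le_smul_of_nonneg_left
      (Finset.sum_le_sum fun k _ => hφ.mono_left (hp k).2.1 (hq k).1) (by positivity)
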